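/- **Setting.** Let $(\Omega,\mathcal A,\mathbb P)$ be a complete probability space with expectation $\mathbb E$, $(E,\|\cdot\|_E)$ a real Banach space with dual $E'$, closed dual unit ball $B_{E'}$, and $\mathbb N=\{1,2,\dots\}$. For $r\in[1,\infty)$ and a Banach space $F$, $L_r(\Omega;F)$ is the Bochner space with norm $\|\eta\|_{L_r(\Omega;F)}=(\mathbb E\|\eta\|_F^r)^{1/r}$. *Tensor products.* For $k\in\mathbb N$, the (full) injective tensor product $\otimes^k_\varepsilon E$ is the completion of the algebraic tensor product $\otimes^kE$ with respect to $$\|U\|_\varepsilon=\sup\{|(f_1\otimes\cdots\otimes f_k)(U)| : f_1,\dots,f_k\in B_{E'}\}.$$ The symmetric algebraic tensor product $\otimes^{k,s}E$ is the linear span in $\otimes^k E$ of all symmetrizations $s(x_1\otimes\cdots\otimes x_k)=\frac1{k!}\sum_{\sigma\in S_k}x_{\sigma(1)}\otimes\cdots\otimes x_{\sigma(k)}$, and the symmetric injective tensor product $\otimes^{k,s}_{\varepsilon_s}E$ is its completion with respect to $\|U\|_{\varepsilon_s}=\sup_{f\in B_{E'}}|(f\otimes\cdots\otimes f)(U)|$.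 Write $\otimes^kx=x\otimes\cdots\otimes x$. For $\xi\in L_k(\Omega;E)$ the injective $k$th moment is the Bochner integral $\mathbb M^k_\varepsilon[\xi]=\mathbb E[\otimes^k\xi]$ in $\otimes^k_\varepsilon E$; it exists, and it is regarded as an element of $\otimes^{k,s}_{\varepsilon_s}E$ through the continuous extension $\otimes^k_\varepsilon E\to\otimes^{k,s}_{\varepsilon_s}E$ of the symmetrization, which leaves it unchanged. *Constants.* A Rademacher family is a sequence $(r_j)_{j\in\mathbb N}$ of independent random variables on a complete probability space $(\widetilde\Omega,\widetilde{\mathcal A},\widetilde{\mathbb P})$ with $\widetilde{\mathbb P}(r_j=1)=\widetilde{\mathbb P}(r_j=-1)=\frac12$. A Banach space $F$ has Rademacher type $p\in[1,2]$ if there is $\tau\in(0,\infty)$ such that $\|\sum_{j=1}^nr_jx_j\|_{L_p(\widetilde\Omega;F)}\le\tau(\sum_{j=1}^n\|x_j\|_F^p)^{1/p}$ for all Rademacher families, all $n$ and all $x_1,\dots,x_n\in F$; $\tau_p(F)$ is the infimum of such $\tau$. For $p,q\in[1,\infty)$, $K_{q,p}$ is the smallest $K\in(0,\infty)$ such that $\|\sum_{j=1}^nr_jx_j\|_{L_q(\widetilde\Omega;F)}\le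 K\|\sum_{j=1}^nr_jx_j\|_{L_p(\widetilde\Omega;F)}$ for all Rademacher families, all real Banach spaces $F$, all $n$ and all $x_1,\dots,x_n\in F$. Finally $B_q$ is the smallest $B\in(0,\infty)$ such that $\|\sum_{j=1}^nr_ja_j\|_{L_q(\widetilde\Omega;\mathbb R)}\le B(\sum_{j=1}^na_j^2)^{1/2}$ for all Rademacher families, all $n$ and all $a_1,\dots,a_n\in\mathbb R$. Set $$C^{\mathsf{SL}}_{q,p,k}:=2\bigl(2k\,K_{q,p}\,\tau_p(E)+B_q\bigr).$$ **Corollary (single-level Monte Carlo).** Assume that $E$ is of Rademacher type $p\in[1,2]$. Let $q\in[p,\infty)$, $k,M\in\mathbb N$, and let $\xi_1,\dots,\xi_M\in L_{kq}(\Omega;E)$ be independent and identically distributed $E$-valued random variables. Then, for every $U\in\otimes^{k,s}_{\varepsilon_s}E$, the random variable $U-\frac1M\sum_{j=1}^M\otimes^k\xi_j$ belongs to $L_q(\Omega;\otimes^{k,s}_{\varepsilon_s}E)$ and $$\Bigl\|U-\frac1M\sum_{j=1}^M\otimes^k\xi_j\Bigr\|_{L_q(\Omega;\otimes^{k,s}_{\varepsilon_s}E)}\le\bigl\|U-\mathbb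 M^k_\varepsilon[\xi_1]\bigr\|_{\varepsilon_s}+C^{\mathsf{SL}}_{q,p,k}\,M^{-(1-\frac1p)}\,\|\xi_1\|^k_{L_{kq}(\Omega;E)}.$$ In particular, for all $\eta\in L_k(\Omega;E)$, $$\bigl\|\mathbb M^k_\varepsilon[\eta]-\mathbb M^k_\varepsilon[\xi_1]\bigr\|_{\varepsilon_s}\le\|\eta-\xi_1\|_{L_k(\Omega;E)}\sum_{i=0}^{k-1}\|\eta\|^i_{L_k(\Omega;E)}\|\xi_1\|^{k-i-1}_{L_k(\Omega;E)}$$ and $$\Bigl\|\mathbb M^k_\varepsilon[\eta]-\frac1M\sum_{j=1}^M\otimes^k\xi_j\Bigr\|_{L_q(\Omega;\otimes^{k,s}_{\varepsilon_s}E)}\le\|\eta-\xi_1\|_{L_k(\Omega;E)}\sum_{i=0}^{k-1}\|\eta\|^i_{L_k(\Omega;E)}\|\xi_1\|^{k-i-1}_{L_k(\Omega;E)}+C^{\mathsf{SL}}_{q,p,k}\,M^{-(1-\frac1p)}\,\|\xi_1\|^k_{L_{kq}(\Omega;E)}.$$ -/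

import Mathlib

open MeasureTheory ProbabilityTheory
open scoped TensorProduct ENNReal

namespace MonteCarloMoments

noncomputable section

/-! ### Algebraic tensor products and the injective norms -/

section Tensor

variable (k : ℕ) (E : Type*) [NormedAddCommGroup E] [NormedSpace ℝ E]

/-- The `k`-fold algebraic tensor product of `E`. It is a type synonym of
`⨂[ℝ] _ : Fin k, E`, which carries the injective norm instead of Mathlib's projective one. -/
def AlgTensor : Type _ := ⨂[ℝ] _ : Fin k, E

instance : AddCommGroup (AlgTensor k E) := inferInstanceAs (AddCommGroup (⨂[ℝ] _ : Fin k, E))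

instance : Module ℝ (AlgTensor k E) := inferInstanceAs (Module ℝ (⨂[ℝ] _ : Fin k, E))

/-- The elementary tensor `x₁ ⊗ ⋯ ⊗ xₖ`, as a multilinear map of `(x₁, …, xₖ)`. -/
def elemTensor : MultilinearMap ℝ (fun _ : Fin k => E) (AlgTensor k E) :=
  PiTensorProduct.tprod ℝ

variable {k E}

/-- The linear functional `f₁ ⊗ ⋯ ⊗ fₖ` on the algebraic tensor product. -/
def tensorEval (f : Fin k → StrongDual ℝ E) : AlgTensor k E →ₗ[ℝ] ℝ :=
  PiTensorProduct.lift
    ((MultilinearMap.mkPiAlgebra ℝ (Fin k) ℝ).compLinearMap fun n => (f n : E →ₗ[ℝ] ℝ))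

theorem tensorEval_elemTensor (f : Fin k → StrongDual ℝ E) (x : Fin k → E) :
    tensorEval f (elemTensor k E x) = ∏ n, f n (x n) := by
  have h := PiTensorProduct.lift.tprod (R := ℝ)
    (φ := (MultilinearMap.mkPiAlgebra ℝ (Fin k) ℝ).compLinearMap
      fun n => (f n : E →ₗ[ℝ] ℝ)) x
  refine h.trans ?_
  simp

theorem algTensor_induction {motive : AlgTensor k E → Prop}
    (smul : ∀ (c : ℝ) (x : Fin k → E), motive (c • elemTensor k E x))
    (add : ∀ U V, motive U → motive V → motive (U + V)) (U : AlgTensor k E) : motive U :=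
  PiTensorProduct.induction_on U smul add

theorem exists_abs_tensorEval_le (U : AlgTensor k E) :
    ∃ C : ℝ, ∀ f : Fin k → Metric.closedBall (0 : StrongDual ℝ E) 1,
      |tensorEval (fun n => (f n : StrongDual ℝ E)) U| ≤ C := by
  refine algTensor_induction
    (motive := fun U => ∃ C : ℝ, ∀ f : Fin k → Metric.closedBall (0 : StrongDual ℝ E) 1,
      |tensorEval (fun n => (f n : StrongDual ℝ E)) U| ≤ C) ?_ ?_ U
  · intro c x
    refine ⟨|c| * ∏ n, ‖x n‖, fun f => ?_⟩
    rw [map_smul, smul_eq_mul, abs_mul, tensorEval_elemTensor, Finset.abs_prod]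
    refine mul_le_mul_of_nonneg_left ?_ (abs_nonneg c)
    refine Finset.prod_le_prod (fun _ _ => abs_nonneg _) fun n _ => ?_
    have h : ‖(f n : StrongDual ℝ E)‖ ≤ 1 := mem_closedBall_zero_iff.mp (f n).2
    calc |(f n : StrongDual ℝ E) (x n)| ≤ ‖(f n : StrongDual ℝ E)‖ * ‖x n‖ :=
          (f n : StrongDual ℝ E).le_opNorm (x n)
      _ ≤ 1 * ‖x n‖ := mul_le_mul_of_nonneg_right h (norm_nonneg _)
      _ = ‖x n‖ := one_mul _
  · rintro U V ⟨C, hC⟩ ⟨D, hD⟩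
    refine ⟨C + D, fun f => ?_⟩
    rw [map_add]
    exact (abs_add_le _ _).trans (add_le_add (hC f) (hD f))

/-- The injective tensor norm: the supremum of `|(f₁ ⊗ ⋯ ⊗ fₖ) U|` over functionals
`f₁, …, fₖ` in the closed unit ball of the dual space. -/
instance : Norm (AlgTensor k E) where
  norm U := ⨆ f : Fin k → Metric.closedBall (0 : StrongDual ℝ E) 1,
    |tensorEval (fun n => (f n : StrongDual ℝ E)) U|

theorem algTensor_norm_def (U : AlgTensor k E) :
    ‖U‖ = ⨆ f : Fin k → Metric.closedBall (0 : StrongDual ℝ E) 1,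
      |tensorEval (fun n => (f n : StrongDual ℝ E)) U| := rfl

theorem abs_tensorEval_le_norm (U : AlgTensor k E)
    (f : Fin k → Metric.closedBall (0 : StrongDual ℝ E) 1) :
    |tensorEval (fun n => (f n : StrongDual ℝ E)) U| ≤ ‖U‖ := by
  obtain ⟨C, hC⟩ := exists_abs_tensorEval_le U
  exact le_ciSup (f := fun f : Fin k → Metric.closedBall (0 : StrongDual ℝ E) 1 =>
    |tensorEval (fun n => (f n : StrongDual ℝ E)) U|) ⟨C, by rintro _ ⟨g, rfl⟩; exact hC g⟩ f

instance : Nonempty (Metric.closedBall (0 : StrongDual ℝ E) 1) := ⟨⟨0, by simp⟩⟩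

theorem algTensor_core : SeminormedSpace.Core ℝ (AlgTensor k E) where
  norm_nonneg U := Real.iSup_nonneg fun _ => abs_nonneg _
  norm_smul c U := by
    simp only [algTensor_norm_def, map_smul, smul_eq_mul, abs_mul, Real.norm_eq_abs]
    exact (Real.mul_iSup_of_nonneg (abs_nonneg c) _).symm
  norm_triangle U V := by
    refine ciSup_le fun f => ?_
    rw [map_add]
    exact (abs_add_le _ _).trans
      (add_le_add (abs_tensorEval_le_norm U f) (abs_tensorEval_le_norm V f))

instance : SeminormedAddCommGroup (AlgTensor k E) := SeminormedAddCommGroup.ofCore algTensor_core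

instance : NormedSpace ℝ (AlgTensor k E) where
  norm_smul_le c U := (algTensor_core.norm_smul c U).le

variable (k E)

/-- The (full) `k`-fold injective tensor product of `E`: the completion of the algebraic tensor
product with respect to the injective norm. -/
abbrev InjTensor : Type _ := UniformSpace.Completion (AlgTensor k E)

/-- The symmetrization
`s(x₁ ⊗ ⋯ ⊗ xₖ) = (1 / k!) ∑_σ x_{σ(1)} ⊗ ⋯ ⊗ x_{σ(k)}`, extended linearly. -/
def symmetrize : AlgTensor k E →ₗ[ℝ] AlgTensor k E :=
  PiTensorProduct.lift
    ((k.factorial : ℝ)⁻¹ • ∑ σ : Equiv.Perm (Fin k), (elemTensor k E).domDomCongr σ)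

variable {k E} in
theorem symmetrize_elemTensor (x : Fin k → E) :
    symmetrize k E (elemTensor k E x)
      = (k.factorial : ℝ)⁻¹ •
          ∑ σ : Equiv.Perm (Fin k), elemTensor k E (fun n => x (σ n)) := by
  have h := PiTensorProduct.lift.tprod (R := ℝ)
    (φ := (k.factorial : ℝ)⁻¹ • ∑ σ : Equiv.Perm (Fin k), (elemTensor k E).domDomCongr σ) x
  refine h.trans ?_
  simp

/-- The `k`-fold symmetric algebraic tensor product of `E`: the linear span of all
symmetrizations `s(x₁ ⊗ ⋯ ⊗ xₖ)`. -/
def symSubmodule : Submodule ℝ (AlgTensor k E) :=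
  Submodule.span ℝ (Set.range fun x : Fin k → E => symmetrize k E (elemTensor k E x))

/-- The `k`-fold symmetric algebraic tensor product as a type of its own; it carries the symmetric
injective norm instead of the norm inherited from `AlgTensor k E`. -/
def SymAlgTensor : Type _ := symSubmodule k E

instance : AddCommGroup (SymAlgTensor k E) := inferInstanceAs (AddCommGroup (symSubmodule k E))

instance : Module ℝ (SymAlgTensor k E) := inferInstanceAs (Module ℝ (symSubmodule k E))

/-- The inclusion of the symmetric into the full algebraic tensor product. -/
def symInclusion : SymAlgTensor k E →ₗ[ℝ] AlgTensor k E := (symSubmodule k E).subtype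

variable {k E}

/-- The symmetric injective tensor norm: the supremum of `|(f ⊗ ⋯ ⊗ f) U|` over `f` in the closed
unit ball of the dual space. For `U = ∑ⱼ λⱼ xⱼ ⊗ ⋯ ⊗ xⱼ` one has
`(f ⊗ ⋯ ⊗ f) U = ∑ⱼ λⱼ f(xⱼ) ^ k`. -/
instance : Norm (SymAlgTensor k E) where
  norm U := ⨆ f : Metric.closedBall (0 : StrongDual ℝ E) 1,
    |tensorEval (fun _ => (f : StrongDual ℝ E)) (symInclusion k E U)|

theorem symAlgTensor_norm_def (U : SymAlgTensor k E) :
    ‖U‖ = ⨆ f : Metric.closedBall (0 : StrongDual ℝ E) 1,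
      |tensorEval (fun _ => (f : StrongDual ℝ E)) (symInclusion k E U)| := rfl

theorem abs_tensorEval_le_symNorm (U : SymAlgTensor k E)
    (f : Metric.closedBall (0 : StrongDual ℝ E) 1) :
    |tensorEval (fun _ => (f : StrongDual ℝ E)) (symInclusion k E U)| ≤ ‖U‖ := by
  obtain ⟨C, hC⟩ := exists_abs_tensorEval_le (symInclusion k E U)
  exact le_ciSup (f := fun f : Metric.closedBall (0 : StrongDual ℝ E) 1 =>
    |tensorEval (fun _ => (f : StrongDual ℝ E)) (symInclusion k E U)|)
    ⟨C, by rintro _ ⟨g, rfl⟩; exact hC fun _ => g⟩ f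

theorem symAlgTensor_core : SeminormedSpace.Core ℝ (SymAlgTensor k E) where
  norm_nonneg U := Real.iSup_nonneg fun _ => abs_nonneg _
  norm_smul c U := by
    simp only [symAlgTensor_norm_def, map_smul, smul_eq_mul, abs_mul, Real.norm_eq_abs]
    exact (Real.mul_iSup_of_nonneg (abs_nonneg c) _).symm
  norm_triangle U V := by
    refine ciSup_le fun f => ?_
    rw [map_add, map_add]
    exact (abs_add_le _ _).trans
      (add_le_add (abs_tensorEval_le_symNorm U f) (abs_tensorEval_le_symNorm V f))

instance : SeminormedAddCommGroup (SymAlgTensor k E) :=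
  SeminormedAddCommGroup.ofCore symAlgTensor_core

instance : NormedSpace ℝ (SymAlgTensor k E) where
  norm_smul_le c U := (symAlgTensor_core.norm_smul c U).le

variable (k E)

/-- The `k`-fold symmetric injective tensor product of `E`: the completion of the symmetric
algebraic tensor product with respect to the symmetric injective norm. -/
abbrev SymInjTensor : Type _ := UniformSpace.Completion (SymAlgTensor k E)

variable {k E}

theorem symmetrize_mem (U : AlgTensor k E) : symmetrize k E U ∈ symSubmodule k E := by
  refine algTensor_induction (motive := fun U => symmetrize k E U ∈ symSubmodule k E) ?_ ?_ U
  · intro c x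
    rw [map_smul]
    exact Submodule.smul_mem _ _ (Submodule.subset_span ⟨x, rfl⟩)
  · intro U V hU hV
    rw [map_add]
    exact Submodule.add_mem _ hU hV

/-- On symmetric functionals the symmetrization is invisible. -/
theorem tensorEval_symmetrize (f : StrongDual ℝ E) (U : AlgTensor k E) :
    tensorEval (fun _ => f) (symmetrize k E U) = tensorEval (fun _ => f) U := by
  refine algTensor_induction
    (motive := fun U => tensorEval (fun _ => f) (symmetrize k E U) = tensorEval (fun _ => f) U)
    ?_ ?_ U
  · intro c x
    have hk : (k.factorial : ℝ) ≠ 0 := by exact_mod_cast k.factorial_ne_zero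
    have h : ∀ σ : Equiv.Perm (Fin k), ∏ n, f (x (σ n)) = ∏ n, f (x n) := fun σ =>
      Equiv.prod_comp σ fun n => f (x n)
    rw [map_smul, map_smul, map_smul, symmetrize_elemTensor, map_smul, map_sum]
    simp only [tensorEval_elemTensor, h, Finset.sum_const, Finset.card_univ, Fintype.card_perm,
      Fintype.card_fin, nsmul_eq_mul, smul_eq_mul]
    rw [inv_mul_cancel_left₀ hk]
  · intro U V hU hV
    rw [map_add, map_add, map_add, hU, hV]

variable (k E) in
/-- The symmetrization as a linear map onto the symmetric algebraic tensor product. -/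
def symProjAlg : AlgTensor k E →ₗ[ℝ] SymAlgTensor k E :=
  (symmetrize k E).codRestrict (symSubmodule k E) symmetrize_mem

theorem norm_symProjAlg_le (U : AlgTensor k E) : ‖symProjAlg k E U‖ ≤ 1 * ‖U‖ := by
  rw [one_mul]
  refine ciSup_le fun f => ?_
  have h : symInclusion k E (symProjAlg k E U) = symmetrize k E U := rfl
  rw [h, tensorEval_symmetrize]
  exact abs_tensorEval_le_norm U fun _ => f

variable (k E) in
/-- The continuous extension of the symmetrization to a linear map from the full onto the symmetric
injective tensor product. -/
def symProj : InjTensor k E →L[ℝ] SymInjTensor k E :=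
  ((symProjAlg k E).mkContinuous 1 norm_symProjAlg_le).completion

variable (k) in
/-- The `k`-fold tensor power `x ⊗ ⋯ ⊗ x` as an element of the full injective tensor product. -/
def tensorPow (x : E) : InjTensor k E := ((elemTensor k E fun _ => x : AlgTensor k E) : InjTensor k E)

theorem elemTensor_diag_mem (x : E) : (elemTensor k E fun _ => x) ∈ symSubmodule k E := by
  have hk : (k.factorial : ℝ) ≠ 0 := by exact_mod_cast k.factorial_ne_zero
  refine Submodule.subset_span ⟨fun _ => x, ?_⟩
  simp only [symmetrize_elemTensor, Finset.sum_const, Finset.card_univ, Fintype.card_perm,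
    Fintype.card_fin]
  rw [← Nat.cast_smul_eq_nsmul ℝ, smul_smul, inv_mul_cancel₀ hk, one_smul]

variable (k) in
/-- The `k`-fold tensor power `x ⊗ ⋯ ⊗ x` as an element of the symmetric algebraic tensor
product. -/
def symElemPow (x : E) : SymAlgTensor k E := ⟨elemTensor k E fun _ => x, elemTensor_diag_mem x⟩

variable (k) in
/-- The `k`-fold tensor power `x ⊗ ⋯ ⊗ x` as an element of the symmetric injective tensor
product. -/
def symTensorPow (x : E) : SymInjTensor k E := (symElemPow k x : SymInjTensor k E)

theorem symProj_tensorPow (x : E) : symProj k E (tensorPow k x) = symTensorPow k x := by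
  have hk : (k.factorial : ℝ) ≠ 0 := by exact_mod_cast k.factorial_ne_zero
  have h : symProjAlg k E (elemTensor k E fun _ => x) = symElemPow k x := by
    refine Subtype.ext ?_
    change symmetrize k E (elemTensor k E fun _ => x) = elemTensor k E fun _ => x
    simp only [symmetrize_elemTensor, Finset.sum_const, Finset.card_univ, Fintype.card_perm,
      Fintype.card_fin]
    rw [← Nat.cast_smul_eq_nsmul ℝ, smul_smul, inv_mul_cancel₀ hk, one_smul]
  have h2 := ContinuousLinearMap.completion_apply_coe
    ((symProjAlg k E).mkContinuous 1 norm_symProjAlg_le) (elemTensor k E fun _ => x)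
  refine h2.trans ?_
  rw [LinearMap.mkContinuous_apply, h]
  rfl

end Tensor

/-! ### Moments -/

section Moments

variable {Ω : Type*} [MeasurableSpace Ω] {E : Type*} [NormedAddCommGroup E] [NormedSpace ℝ E]

/-- The injective `k`-th moment of `ξ`: the Bochner integral of `ξ ⊗ ⋯ ⊗ ξ` in the full injective
tensor product. -/
def injMoment (k : ℕ) (ξ : Ω → E) (P : Measure Ω) : InjTensor k E :=
  ∫ ω, tensorPow k (ξ ω) ∂P

/-- The injective `k`-th moment, regarded as an element of the symmetric injective tensor product
by means of the symmetrization (which leaves it unchanged). -/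
def symMoment (k : ℕ) (ξ : Ω → E) (P : Measure Ω) : SymInjTensor k E :=
  symProj k E (injMoment k ξ P)

end Moments

/-! ### Rademacher families and the constants

The constants below are infima of sets of admissible constants. Rademacher families are taken on
probability spaces in `Type`; the distribution of `∑ⱼ rⱼ xⱼ` does not depend on the probability
space, so this is no restriction. -/

/-- A sequence of independent random signs, each equal to `1` or `-1` with probability `1 / 2`. -/
structure IsRademacherFamily {Ω : Type*} [MeasurableSpace Ω] (P : Measure Ω) (r : ℕ → Ω → ℝ) :
    Prop where
  measurable : ∀ j, Measurable (r j)
  eq_or_eq : ∀ j ω, r j ω = -1 ∨ r j ω = 1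
  measure_neg_one : ∀ j, P {ω | r j ω = -1} = 1 / 2
  measure_one : ∀ j, P {ω | r j ω = 1} = 1 / 2
  indep : iIndepFun r P

/-- `τ` is admissible in the type `p` inequality of the space `F`. -/
def IsTypeConstant (F : Type*) [NormedAddCommGroup F] [NormedSpace ℝ F] (p τ : ℝ) : Prop :=
  0 < τ ∧ ∀ (Ω : Type) [MeasurableSpace Ω] (P : Measure Ω) [IsProbabilityMeasure P] [P.IsComplete]
    (r : ℕ → Ω → ℝ), IsRademacherFamily P r → ∀ (n : ℕ) (x : Fin n → F),
      lpNorm (fun ω => ∑ j : Fin n, r j ω • x j) (ENNReal.ofReal p) P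
        ≤ τ * (∑ j : Fin n, ‖x j‖ ^ p) ^ (1 / p)

/-- `F` has Rademacher type `p`. -/
def HasRademacherType (F : Type*) [NormedAddCommGroup F] [NormedSpace ℝ F] (p : ℝ) : Prop :=
  ∃ τ : ℝ, IsTypeConstant F p τ

/-- The type `p` constant `τ_p(F)`. -/
def typeConstant (F : Type*) [NormedAddCommGroup F] [NormedSpace ℝ F] (p : ℝ) : ℝ :=
  sInf {τ : ℝ | IsTypeConstant F p τ}

universe u

/-- The `(q, p)` Kahane–Khintchine constant: the smallest `K` such that
`‖∑ⱼ rⱼ xⱼ‖_{L_q} ≤ K ‖∑ⱼ rⱼ xⱼ‖_{L_p}` for all Banach spaces, all finite families of vectors and all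
Rademacher families. (Only the finite-dimensional span of the vectors matters, so the value does not
depend on the universe of the Banach spaces.) -/
def kahaneKhintchineConstant (q p : ℝ) : ℝ :=
  sInf {K : ℝ | 0 < K ∧ ∀ (Ω : Type) [MeasurableSpace Ω] (P : Measure Ω) [IsProbabilityMeasure P]
    [P.IsComplete] (r : ℕ → Ω → ℝ), IsRademacherFamily P r →
    ∀ (F : Type u) [NormedAddCommGroup F] [NormedSpace ℝ F] [CompleteSpace F]
      (n : ℕ) (x : Fin n → F),
      lpNorm (fun ω => ∑ j : Fin n, r j ω • x j) (ENNReal.ofReal q) P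
        ≤ K * lpNorm (fun ω => ∑ j : Fin n, r j ω • x j) (ENNReal.ofReal p) P}

/-- The constant `B_q` of the classical Khintchine inequality: the smallest `B` such that
`‖∑ⱼ rⱼ aⱼ‖_{L_q} ≤ B (∑ⱼ aⱼ²)^{1/2}` for all finite families of reals and all Rademacher
families. -/
def khintchineConstant (q : ℝ) : ℝ :=
  sInf {B : ℝ | 0 < B ∧ ∀ (Ω : Type) [MeasurableSpace Ω] (P : Measure Ω) [IsProbabilityMeasure P]
    [P.IsComplete] (r : ℕ → Ω → ℝ), IsRademacherFamily P r → ∀ (n : ℕ) (a : Fin n → ℝ),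
      lpNorm (fun ω => ∑ j : Fin n, r j ω * a j) (ENNReal.ofReal q) P
        ≤ B * (∑ j : Fin n, a j ^ 2) ^ (1 / 2 : ℝ)}

/-- The single-level constant `2 (2 k K_{q,p} τ_p(E) + B_q)`. -/
def singleLevelConstant (E : Type u) [NormedAddCommGroup E] [NormedSpace ℝ E] (q p : ℝ) (k : ℕ) :
    ℝ :=
  2 * (2 * k * kahaneKhintchineConstant.{u} q p * typeConstant E p + khintchineConstant q)

end

end MonteCarloMoments

open MonteCarloMoments

/-! Split `U` minus the sample mean at the exact moment of `ξ₁`. One piece is constant; the other is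
a centred average of i.i.d. tensor powers. After transfer to a product space
(`exists_measurePreserving_pi`), symmetrization with an independent copy
(`lpNorm_sum_sub_integral_rpow_le`) bounds the `q`-th moment of the centred sum by `2 ^ q` times the
expected sign average of `‖∑ εⱼ ⊗ᵏ xⱼ‖ ^ q`.

By definition of the symmetric injective norm this is a supremum of `|∑ εⱼ f(xⱼ) ^ k|` over the dual
unit ball. For `|t| ≤ ‖xⱼ‖` the power `t ^ k` is dominated by, and Lipschitz with respect to, the
linear function `k ‖xⱼ‖ ^ (k - 1) t`. The Ledoux–Talagrand contraction principle
(`signAvg_iSup_abs_contraction`) therefore linearizes the supremum at the cost of a factor 2, and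
what remains is the norm of a Rademacher sum in `E` itself. Kahane's inequality, type `p` and a
power mean inequality (`signAvg_norm_symTensorPow_le_sum`) give growth `M ^ (1 / p)`, and division
by `M` gives the rate. The constant obtained is `2 · 2k K τ`; the summand `B_q ≥ 0` is then simply
added.

The constants are infima, so they bound something only if the admissible sets are nonempty and
Rademacher families exist (`exists_isRademacherFamily`). For `K` this means proving Kahane's
inequality uniformly in the space: an `L₂`–`L_{2L}` hypercontractive estimate on the sign cube
(`signAvg_norm_pow_le`), plus a reverse Hölder inequality from second to first moments.

The difference of two moments needs no probability beyond Hölder's inequality: factor `a ^ k - b ^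
k` under each functional and integrate. -/

namespace MonteCarloMoments

/-! ### Averages over signs -/

section SignAverage

/-- The sign `1` or `-1` encoded by a Boolean. -/
def boolSign (b : Bool) : ℝ := if b then 1 else -1

/-- The average of `Φ` over all sign vectors of length `n`. -/
noncomputable def signAvg (n : ℕ) (Φ : (Fin n → ℝ) → ℝ) : ℝ :=
  ((2 : ℝ) ^ n)⁻¹ * ∑ ε : Fin n → Bool, Φ fun j => boolSign (ε j)

theorem signAvg_zero (Φ : (Fin 0 → ℝ) → ℝ) : signAvg 0 Φ = Φ Fin.elim0 := by
  simp only [signAvg, pow_zero, inv_one, one_mul, Finset.univ_unique, Finset.sum_singleton]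
  exact congrArg Φ (Subsingleton.elim _ _)

/-- Conditioning on the first sign; both the contraction principle and hypercontractivity are proved
by induction through this identity. -/
theorem signAvg_succ {n : ℕ} (Φ : (Fin (n + 1) → ℝ) → ℝ) :
    signAvg (n + 1) Φ
      = (signAvg n (fun e => Φ (Fin.cons 1 e)) + signAvg n fun e => Φ (Fin.cons (-1) e)) / 2 := by
  have h : ∀ (b : Bool) (ε : Fin n → Bool),
      (fun j => boolSign ((Fin.cons b ε : Fin (n + 1) → Bool) j))
        = (Fin.cons (boolSign b) fun j => boolSign (ε j) : Fin (n + 1) → ℝ) := by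
    intro b ε
    funext j
    refine Fin.cases ?_ (fun i => ?_) j <;> simp
  have hsum : ∑ ε : Fin (n + 1) → Bool, Φ (fun j => boolSign (ε j))
      = ∑ x : Bool × (Fin n → Bool), Φ (Fin.cons (boolSign x.1) fun j => boolSign (x.2 j)) := by
    refine (Fintype.sum_equiv (Fin.consEquiv fun _ => Bool) _ _ fun x => ?_).symm
    rw [← h]
    rfl
  rw [signAvg, hsum, Fintype.sum_prod_type]
  simp only [Fintype.sum_bool, signAvg, boolSign, if_true, Bool.false_eq_true, if_false, pow_succ,
    mul_inv]
  ring

theorem signAvg_mono {n : ℕ} {Φ Ψ : (Fin n → ℝ) → ℝ} (h : ∀ e, Φ e ≤ Ψ e) :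
    signAvg n Φ ≤ signAvg n Ψ :=
  mul_le_mul_of_nonneg_left (Finset.sum_le_sum fun _ _ => h _) (by positivity)

theorem signAvg_nonneg {n : ℕ} {Φ : (Fin n → ℝ) → ℝ} (h : ∀ e, 0 ≤ Φ e) : 0 ≤ signAvg n Φ :=
  mul_nonneg (by positivity) (Finset.sum_nonneg fun _ _ => h _)

theorem signAvg_add {n : ℕ} (Φ Ψ : (Fin n → ℝ) → ℝ) :
    signAvg n (fun e => Φ e + Ψ e) = signAvg n Φ + signAvg n Ψ := by
  simp only [signAvg, Finset.sum_add_distrib, mul_add]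

theorem signAvg_const_mul {n : ℕ} (c : ℝ) (Φ : (Fin n → ℝ) → ℝ) :
    signAvg n (fun e => c * Φ e) = c * signAvg n Φ := by
  simp only [signAvg, ← Finset.mul_sum]
  ring

theorem signAvg_neg {n : ℕ} (Φ : (Fin n → ℝ) → ℝ) :
    signAvg n (fun e => Φ (-e)) = signAvg n Φ := by
  simp only [signAvg]
  congr 1
  refine Fintype.sum_equiv (Equiv.piCongrRight fun _ => Equiv.boolNot) _ _ fun ε => ?_
  congr 1
  funext j
  cases h : ε j <;> simp [boolSign, h]

end SignAverage

/-! ### The contraction principle -/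

section Contraction

/-- Weak majorization for pairs. With `B ≤ A`, either `x ≤ B`, and monotonicity suffices, or `x` and
`A + B - x` are mirrored convex combinations of `A` and `B`, and `y ≤ A + B - x`. -/
theorem add_le_add_of_weakly_majorized {G : ℝ → ℝ} (hc : ConvexOn ℝ Set.univ G) (hm : Monotone G)
    {x y A B : ℝ} (hx : x ≤ max A B) (hy : y ≤ max A B) (hxy : x + y ≤ A + B) :
    G x + G y ≤ G A + G B := by
  wlog hAB : B ≤ A generalizing A B
  · rw [add_comm (G A)]
    exact this (by rwa [max_comm]) (by rwa [max_comm]) (by linarith) (le_of_not_ge hAB)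
  rw [max_eq_left hAB] at hx hy
  rcases le_or_gt x B with hxB | hxB
  · linarith [hm hxB, hm hy]
  · have hpos : 0 < A - B := by linarith
    have ht : 0 ≤ (x - B) / (A - B) := div_nonneg (by linarith) hpos.le
    have ht' : 0 ≤ (A - x) / (A - B) := div_nonneg (by linarith) hpos.le
    have hsum : (x - B) / (A - B) + (A - x) / (A - B) = 1 := by field_simp; ring
    have hsum' : (A - x) / (A - B) + (x - B) / (A - B) = 1 := by rw [add_comm, hsum]
    have h1 := hc.2 (Set.mem_univ A) (Set.mem_univ B) ht ht' hsum
    have h2 := hc.2 (Set.mem_univ A) (Set.mem_univ B) ht' ht hsum'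
    have e1 : ((x - B) / (A - B)) • A + ((A - x) / (A - B)) • B = x := by
      simp only [smul_eq_mul]; field_simp; ring
    have e2 : ((A - x) / (A - B)) • A + ((x - B) / (A - B)) • B = A + B - x := by
      simp only [smul_eq_mul]; field_simp; ring
    rw [e1] at h1
    rw [e2] at h2
    simp only [smul_eq_mul] at h1 h2
    have h3 : G y ≤ G (A + B - x) := hm (by linarith)
    have h4 : ((x - B) / (A - B)) * G A + ((A - x) / (A - B)) * G B
        + (((A - x) / (A - B)) * G A + ((x - B) / (A - B)) * G B) = G A + G B := by
      linear_combination (G A + G B) * hsum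
    linarith

theorem bddAbove_range_of_abs_le {T : Type*} {f : T → ℝ} (h : ∃ C, ∀ t, |f t| ≤ C) :
    BddAbove (Set.range f) := by
  obtain ⟨C, hC⟩ := h
  exact ⟨C, by rintro _ ⟨t, rfl⟩; exact (le_abs_self _).trans (hC t)⟩

theorem exists_abs_add_le {T : Type*} {f g : T → ℝ} (hf : ∃ C, ∀ t, |f t| ≤ C)
    (hg : ∃ C, ∀ t, |g t| ≤ C) : ∃ C, ∀ t, |f t + g t| ≤ C := by
  obtain ⟨C, hC⟩ := hf
  obtain ⟨D, hD⟩ := hg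
  exact ⟨C + D, fun t => (abs_add_le _ _).trans (add_le_add (hC t) (hD t))⟩

theorem exists_abs_mul_le {T : Type*} (c : ℝ) {f : T → ℝ} (hf : ∃ C, ∀ t, |f t| ≤ C) :
    ∃ C, ∀ t, |c * f t| ≤ C := by
  obtain ⟨C, hC⟩ := hf
  exact ⟨|c| * C, fun t => by
    rw [abs_mul]; exact mul_le_mul_of_nonneg_left (hC t) (abs_nonneg c)⟩

theorem exists_abs_sum_le {T ι : Type*} [Fintype ι] {f : ι → T → ℝ}
    (hf : ∀ i, ∃ C, ∀ t, |f i t| ≤ C) : ∃ C, ∀ t, |∑ i, f i t| ≤ C := by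
  choose C hC using hf
  exact ⟨∑ i, C i, fun t =>
    (Finset.abs_sum_le_sum_abs _ _).trans (Finset.sum_le_sum fun i _ => hC i t)⟩

/-- The contraction principle for a single sign. -/
theorem iSup_add_contraction {T : Type*} [Nonempty T] {G : ℝ → ℝ} (hc : ConvexOn ℝ Set.univ G)
    (hm : Monotone G) {h u v : T → ℝ} (hh : ∃ C, ∀ t, |h t| ≤ C) (hu : ∃ C, ∀ t, |u t| ≤ C)
    (hvu : ∀ t, |v t| ≤ |u t|) (hlip : ∀ s t, |v s - v t| ≤ |u s - u t|) :
    G (⨆ t, (h t + v t)) + G (⨆ t, (h t + -1 * v t))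
      ≤ G (⨆ t, (h t + u t)) + G (⨆ t, (h t + -1 * u t)) := by
  have hA : ∀ t, h t + u t ≤ ⨆ t, (h t + u t) :=
    le_ciSup (bddAbove_range_of_abs_le (exists_abs_add_le hh hu))
  have hB : ∀ t, h t + -1 * u t ≤ ⨆ t, (h t + -1 * u t) :=
    le_ciSup (bddAbove_range_of_abs_le (exists_abs_add_le hh (exists_abs_mul_le (-1) hu)))
  set A := ⨆ t, (h t + u t)
  set B := ⨆ t, (h t + -1 * u t)
  -- `|u t|` is one of `u t` and `-u t`, so domination of `v` by `u` bounds both suprema on the left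
  -- by `max A B`.
  have habs : ∀ t, h t + |u t| ≤ max A B := by
    intro t
    rcases abs_cases (u t) with ⟨e, _⟩ | ⟨e, _⟩ <;> rw [e]
    · exact (hA t).trans (le_max_left _ _)
    · exact le_trans (by linarith [hB t]) (le_max_right A B)
  refine add_le_add_of_weakly_majorized hc hm (ciSup_le fun t => ?_) (ciSup_le fun t => ?_) ?_
  · linarith [habs t, le_abs_self (v t), hvu t]
  · linarith [habs t, neg_abs_le (v t), hvu t]
  -- For the sum, compare points `s` and `t` jointly: the sign of `u s - u t` decides which of them
  -- is charged to `A` and which to `B`.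
  · rw [← le_sub_iff_add_le]
    refine ciSup_le fun s => ?_
    rw [le_sub_iff_add_le, ← le_sub_iff_add_le']
    refine ciSup_le fun t => ?_
    have h1 := (le_abs_self _).trans (hlip s t)
    rcases abs_cases (u s - u t) with ⟨e, _⟩ | ⟨e, _⟩ <;> rw [e] at h1
    · linarith [hA s, hB t]
    · linarith [hA t, hB s]

/-- The contraction principle for averages over signs. -/
theorem signAvg_iSup_contraction {T : Type*} [Nonempty T] {G : ℝ → ℝ}
    (hc : ConvexOn ℝ Set.univ G) (hm : Monotone G) {n : ℕ} {u v : Fin n → T → ℝ} {h : T → ℝ}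
    (hh : ∃ C, ∀ t, |h t| ≤ C) (hu : ∀ i, ∃ C, ∀ t, |u i t| ≤ C)
    (hvu : ∀ i t, |v i t| ≤ |u i t|) (hlip : ∀ i s t, |v i s - v i t| ≤ |u i s - u i t|) :
    signAvg n (fun e => G (⨆ t, (h t + ∑ i, e i * v i t)))
      ≤ signAvg n fun e => G (⨆ t, (h t + ∑ i, e i * u i t)) := by
  -- The offset `h` absorbs the contribution of signs already fixed.
  induction n generalizing h with
  | zero => simp [signAvg_zero]
  | succ n ih =>
    have hv0 : ∃ C, ∀ t, |v 0 t| ≤ C := by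
      obtain ⟨C, hC⟩ := hu 0
      exact ⟨C, fun t => (hvu 0 t).trans (hC t)⟩
    have step : ∀ c : ℝ, signAvg n (fun e => G (⨆ t, (h t + c * v 0 t + ∑ i, e i * v i.succ t)))
        ≤ signAvg n fun e => G (⨆ t, (h t + c * v 0 t + ∑ i, e i * u i.succ t)) := fun c =>
      ih (u := fun i => u i.succ) (v := fun i => v i.succ)
        (exists_abs_add_le hh (exists_abs_mul_le c hv0)) (fun i => hu i.succ)
        (fun i => hvu i.succ) fun i => hlip i.succ
    simp only [signAvg_succ, Fin.sum_univ_succ, Fin.cons_zero, Fin.cons_succ, ← add_assoc]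
    -- The last `n` coordinates are exchanged with the first sign frozen; then the first one is
    -- exchanged pointwise in the others.
    refine div_le_div_of_nonneg_right ((add_le_add (step 1) (step (-1))).trans ?_) (by norm_num)
    rw [← signAvg_add, ← signAvg_add]
    refine signAvg_mono fun e => ?_
    have hbd : ∃ C, ∀ t, |h t + ∑ i, e i * u i.succ t| ≤ C :=
      exists_abs_add_le hh (exists_abs_sum_le fun i => exists_abs_mul_le (e i) (hu i.succ))
    have key := iSup_add_contraction hc hm hbd (hu 0) (hvu 0) (hlip 0)
    simpa only [one_mul, add_right_comm] using key

theorem convexOn_max_zero_rpow {q : ℝ} (hq : 1 ≤ q) :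
    ConvexOn ℝ Set.univ fun x : ℝ => max x 0 ^ q := by
  have h1 : ConvexOn ℝ Set.univ fun x : ℝ => max x 0 :=
    (convexOn_id convex_univ).sup (convexOn_const 0 convex_univ)
  refine ⟨convex_univ, fun x _ y _ a b ha hb hab => ?_⟩
  have h2 := h1.2 (Set.mem_univ x) (Set.mem_univ y) ha hb hab
  have h3 := (convexOn_rpow hq).2 (Set.mem_Ici.2 (le_max_right x 0))
    (Set.mem_Ici.2 (le_max_right y 0)) ha hb hab
  exact (Real.rpow_le_rpow (le_max_right _ _) h2 (by linarith)).trans h3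

theorem monotone_max_zero_rpow {q : ℝ} (hq : 0 ≤ q) : Monotone fun x : ℝ => max x 0 ^ q :=
  fun _ _ hxy => Real.rpow_le_rpow (le_max_right _ _) (max_le_max_right 0 hxy) hq

/-- The contraction principle for suprema of absolute values. -/
theorem signAvg_iSup_abs_contraction {T : Type*} [Nonempty T] {q : ℝ} (hq : 1 ≤ q) {n : ℕ}
    {u v : Fin n → T → ℝ} (hu : ∀ i, ∃ C, ∀ t, |u i t| ≤ C)
    (hvu : ∀ i t, |v i t| ≤ |u i t|) (hlip : ∀ i s t, |v i s - v i t| ≤ |u i s - u i t|) :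
    signAvg n (fun e => (⨆ t, |∑ i, e i * v i t|) ^ q)
      ≤ 2 ^ q * signAvg n fun e => (⨆ t, |∑ i, e i * u i t|) ^ q := by
  have hq0 : 0 ≤ q := by linarith
  have hv : ∀ i, ∃ C, ∀ t, |v i t| ≤ C := fun i => by
    obtain ⟨C, hC⟩ := hu i
    exact ⟨C, fun t => (hvu i t).trans (hC t)⟩
  -- Truncating at zero makes the power monotone and convex on the whole line.
  set G : ℝ → ℝ := fun x => max x 0 ^ q with hG
  set Sv : (Fin n → ℝ) → ℝ := fun e => ⨆ t, ∑ i, e i * v i t with hSv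
  have hsum : ∀ (w : Fin n → T → ℝ), (∀ i, ∃ C, ∀ t, |w i t| ≤ C) → ∀ e : Fin n → ℝ,
      ∃ C, ∀ t, |∑ i, e i * w i t| ≤ C := fun w hw e =>
    exists_abs_sum_le fun i => exists_abs_mul_le (e i) (hw i)
  have hcontr : signAvg n (fun e => G (Sv e))
      ≤ signAvg n fun e => (⨆ t, |∑ i, e i * u i t|) ^ q := by
    have h := signAvg_iSup_contraction (convexOn_max_zero_rpow hq) (monotone_max_zero_rpow hq0)
      (h := fun _ => 0) ⟨0, by simp⟩ hu hvu hlip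
    simp only [zero_add] at h
    refine h.trans (signAvg_mono fun e => Real.rpow_le_rpow (le_max_right _ _) ?_ hq0)
    obtain ⟨C, hC⟩ := hsum u hu e
    exact max_le (ciSup_mono ⟨C, by rintro _ ⟨t, rfl⟩; exact hC t⟩ fun t => le_abs_self _)
      (Real.iSup_nonneg fun _ => abs_nonneg _)
  -- The absolute supremum is at most the sum of the positive parts of the suprema at `e` and `-e`.
  -- Convexity gives the factor `2 ^ q`, and by symmetry both terms have the same average.
  have hpt : ∀ e : Fin n → ℝ, (⨆ t, |∑ i, e i * v i t|) ^ q
      ≤ 2 ^ q * (2⁻¹ * (G (Sv e) + G (Sv (-e)))) := by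
    intro e
    have hle : ∀ e' : Fin n → ℝ, ∀ t, ∑ i, e' i * v i t ≤ Sv e' := fun e' =>
      le_ciSup (bddAbove_range_of_abs_le (hsum v hv e'))
    have h1 : ⨆ t, |∑ i, e i * v i t| ≤ max (Sv e) 0 + max (Sv (-e)) 0 := by
      refine ciSup_le fun t => abs_le'.2 ⟨?_, ?_⟩
      · linarith [hle e t, le_max_left (Sv e) 0, le_max_right (Sv (-e)) 0]
      · have := hle (-e) t
        simp only [Pi.neg_apply, neg_mul, Finset.sum_neg_distrib] at this
        linarith [le_max_right (Sv e) 0, le_max_left (Sv (-e)) 0]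
    have h2 := (convexOn_rpow hq).2 (Set.mem_Ici.2 (le_max_right (Sv e) 0))
      (Set.mem_Ici.2 (le_max_right (Sv (-e)) 0)) (by norm_num : (0 : ℝ) ≤ 2⁻¹)
      (by norm_num : (0 : ℝ) ≤ 2⁻¹) (by norm_num)
    simp only [smul_eq_mul, ← mul_add] at h2
    calc (⨆ t, |∑ i, e i * v i t|) ^ q
        ≤ (2 * (2⁻¹ * (max (Sv e) 0 + max (Sv (-e)) 0))) ^ q :=
          Real.rpow_le_rpow (Real.iSup_nonneg fun _ => abs_nonneg _) (by linarith) hq0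
      _ = 2 ^ q * (2⁻¹ * (max (Sv e) 0 + max (Sv (-e)) 0)) ^ q :=
          Real.mul_rpow (by norm_num) (by positivity)
      _ ≤ _ := mul_le_mul_of_nonneg_left h2 (by positivity)
  refine (signAvg_mono hpt).trans ?_
  rw [signAvg_const_mul, signAvg_const_mul, signAvg_add, signAvg_neg fun e => G (Sv e)]
  refine mul_le_mul_of_nonneg_left ?_ (by positivity)
  linarith

end Contraction

/-! ### Hypercontractivity on the sign cube -/

section Hypercontractivity

/-- Minkowski's inequality for the normalized `ℓ^L` norm on two points: the norm of an average is at
most the average of the norms. It follows from Jensen's inequality for `t ↦ t ^ L` after reweighting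
by `c`. -/
theorem signAvg_pow_add_pow_le {n L : ℕ} {a b c : (Fin n → ℝ) → ℝ} (ha : ∀ e, 0 ≤ a e)
    (hb : ∀ e, 0 ≤ b e) (hc : ∀ e, 0 ≤ c e) (hL : L ≠ 0)
    (h : ∀ e, a e ^ L + b e ^ L ≤ 2 * c e ^ L) :
    signAvg n a ^ L + signAvg n b ^ L ≤ 2 * signAvg n c ^ L := by
  -- Where `c` vanishes so do `a` and `b`, so the quotients by `c` below lose nothing.
  have hzero : ∀ f : (Fin n → ℝ) → ℝ, (∀ e, 0 ≤ f e) → (∀ e, f e ^ L ≤ 2 * c e ^ L) →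
      ∀ e, c e = 0 → f e = 0 := by
    intro f hf hfc e he
    have h1 := hfc e
    rw [he, zero_pow hL, mul_zero] at h1
    exact (pow_eq_zero_iff hL).1 (le_antisymm h1 (pow_nonneg (hf e) L))
  have ha' := hzero a ha fun e => by linarith [h e, pow_nonneg (hb e) L]
  have hb' := hzero b hb fun e => by linarith [h e, pow_nonneg (ha e) L]
  rcases (signAvg_nonneg hc).eq_or_lt with hC | hC
  · have hc0 : ∀ ε : Fin n → Bool, c (fun j => boolSign (ε j)) = 0 := by
      have h1 : ∑ ε : Fin n → Bool, c (fun j => boolSign (ε j)) = 0 := by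
        have h2 : ((2 : ℝ) ^ n)⁻¹ ≠ 0 := by positivity
        exact (mul_eq_zero.1 hC.symm).resolve_left h2
      intro ε
      exact (Finset.sum_eq_zero_iff_of_nonneg fun _ _ => hc _).1 h1 ε (Finset.mem_univ ε)
    have h1 : signAvg n a = 0 := by simp [signAvg, ha' _ (hc0 _)]
    have h2 : signAvg n b = 0 := by simp [signAvg, hb' _ (hc0 _)]
    rw [h1, h2, ← hC, zero_pow hL]
    norm_num
  · set C := signAvg n c with hCdef
    have jensen : ∀ f : (Fin n → ℝ) → ℝ, (∀ e, 0 ≤ f e) → (∀ e, c e = 0 → f e = 0) →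
        (signAvg n f / C) ^ L ≤ signAvg n (fun e => c e / C * (f e / c e) ^ L) := by
      intro f hf hf0
      have h1 := Real.pow_arith_mean_le_arith_mean_pow (Finset.univ : Finset (Fin n → Bool))
        (fun ε => ((2 : ℝ) ^ n)⁻¹ * (c (fun j => boolSign (ε j)) / C))
        (fun ε => f (fun j => boolSign (ε j)) / c (fun j => boolSign (ε j)))
        (fun ε _ => mul_nonneg (by positivity) (div_nonneg (hc _) hC.le))
        (by
          rw [← Finset.mul_sum, ← Finset.sum_div, ← mul_div_assoc]
          exact div_self hC.ne')
        (fun ε _ => div_nonneg (hf _) (hc _)) L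
      have h2 : ∑ ε : Fin n → Bool, ((2 : ℝ) ^ n)⁻¹ * (c (fun j => boolSign (ε j)) / C)
          * (f (fun j => boolSign (ε j)) / c (fun j => boolSign (ε j))) = signAvg n f / C := by
        rw [signAvg, mul_div_assoc, Finset.sum_div, Finset.mul_sum]
        refine Finset.sum_congr rfl fun ε _ => ?_
        rcases eq_or_ne (c fun j => boolSign (ε j)) 0 with h0 | h0
        · simp [h0, hf0 _ h0]
        · field_simp
      rw [h2] at h1
      refine h1.trans (le_of_eq ?_)
      rw [signAvg, Finset.mul_sum]
      exact Finset.sum_congr rfl fun ε _ => by ring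
    have h3 := add_le_add (jensen a ha ha') (jensen b hb hb')
    have h4 : signAvg n (fun e => c e / C * (a e / c e) ^ L)
        + signAvg n (fun e => c e / C * (b e / c e) ^ L) ≤ 2 := by
      rw [← signAvg_add]
      calc signAvg n (fun e => c e / C * (a e / c e) ^ L + c e / C * (b e / c e) ^ L)
          ≤ signAvg n (fun e => (2 / C) * c e) := by
            refine signAvg_mono fun e => ?_
            rcases (hc e).eq_or_lt with h0 | h0
            · simp [← h0]
            · have h5 : (a e / c e) ^ L + (b e / c e) ^ L ≤ 2 := by
                rw [div_pow, div_pow, ← add_div, div_le_iff₀ (pow_pos h0 L)]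
                exact h e
              rw [← mul_add]
              calc c e / C * ((a e / c e) ^ L + (b e / c e) ^ L) ≤ c e / C * 2 :=
                    mul_le_mul_of_nonneg_left h5 (div_nonneg h0.le hC.le)
                _ = 2 / C * c e := by ring
        _ = 2 := by
            rw [signAvg_const_mul, ← hCdef]
            exact div_mul_cancel₀ 2 hC.ne'
    have h6 := h3.trans h4
    rwa [div_pow, div_pow, ← add_div, div_le_iff₀ (pow_pos hC L)] at h6

/-- The even and odd parts of `(P ± Q) ^ l` satisfy a coupled recursion, so they are bounded
together by induction on `l`; `L * δ ≤ 1` keeps the odd part small enough up to `l = L`. -/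
theorem add_pow_add_sub_pow_le {P Q c δ : ℝ} (hP : 0 ≤ P) (hc : 0 ≤ c) (hδ : 0 ≤ δ)
    (hQ : Q ^ 2 ≤ δ * P * c) {L : ℕ} (hL : L * δ ≤ 1) :
    (P + Q) ^ L + (P - Q) ^ L ≤ 2 * (P + c) ^ L := by
  suffices h : ∀ l ≤ L, (P + Q) ^ l + (P - Q) ^ l ≤ 2 * (P + c) ^ l ∧
      Q * ((P + Q) ^ l - (P - Q) ^ l) ≤ 2 * (l * δ * c * (P + c) ^ l) from (h L le_rfl).1
  intro l
  induction l with
  | zero => intro _; norm_num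
  | succ l ih =>
    intro hl
    obtain ⟨h1, h2⟩ := ih (by omega)
    have hpow : 0 ≤ (P + c) ^ l := by positivity
    have hlδ : (l : ℝ) * δ ≤ 1 := by
      refine le_trans (mul_le_mul_of_nonneg_right ?_ hδ) hL
      exact_mod_cast (by omega : l ≤ L)
    have h3 : (l : ℝ) * δ * (c * (P + c) ^ l) ≤ 1 * (c * (P + c) ^ l) :=
      mul_le_mul_of_nonneg_right hlδ (by positivity)
    have hQ' : Q ^ 2 * ((P + Q) ^ l + (P - Q) ^ l) ≤ δ * P * c * (2 * (P + c) ^ l) :=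
      (mul_le_mul_of_nonneg_left h1 (sq_nonneg Q)).trans
        (mul_le_mul_of_nonneg_right hQ (by positivity))
    have hPh1 := mul_le_mul_of_nonneg_left h1 hP
    have hPh2 := mul_le_mul_of_nonneg_left h2 hP
    constructor
    · have e : (P + Q) ^ (l + 1) + (P - Q) ^ (l + 1)
          = P * ((P + Q) ^ l + (P - Q) ^ l) + Q * ((P + Q) ^ l - (P - Q) ^ l) := by ring
      rw [e, pow_succ (P + c)]
      nlinarith
    · have e : Q * ((P + Q) ^ (l + 1) - (P - Q) ^ (l + 1))
          = P * (Q * ((P + Q) ^ l - (P - Q) ^ l)) + Q ^ 2 * ((P + Q) ^ l + (P - Q) ^ l) := by ring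
      rw [e, pow_succ (P + c)]
      push_cast
      have h4 : 0 ≤ ((l : ℝ) + 1) * δ * c * (P + c) ^ l * c := by positivity
      nlinarith

variable {F : Type*} [NormedAddCommGroup F] [NormedSpace ℝ F]

/-- The two-point inequality behind hypercontractivity. -/
theorem norm_two_point_le {L : ℕ} (hL : L ≠ 0) (x y : F) :
    ‖x + (4 * (L : ℝ))⁻¹ • y‖ ^ (2 * L) + ‖x - (4 * (L : ℝ))⁻¹ • y‖ ^ (2 * L)
      ≤ 2 * ((‖x + y‖ ^ 2 + ‖x - y‖ ^ 2) / 2) ^ L := by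
  have hL1 : (1 : ℝ) ≤ L := by exact_mod_cast Nat.one_le_iff_ne_zero.2 hL
  -- Chosen so that `1 / L = 4σ`, whence `4σ² ≤ (1 - σ²) / L` for `σ ≤ 1 / 4`.
  set σ : ℝ := (4 * (L : ℝ))⁻¹ with hσ
  have hσL : σ * L = 1 / 4 := by rw [hσ]; field_simp
  have hσ0 : 0 < σ := by positivity
  have hσ1 : σ ≤ 1 / 4 := by nlinarith
  -- Reduction to scalars: `x ± σ y` are convex combinations of `x + y` and `x - y`, so their norms
  -- are at most `m ± σ d`.
  set m := (‖x + y‖ + ‖x - y‖) / 2 with hm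
  set d := (‖x + y‖ - ‖x - y‖) / 2 with hd
  have h1 : ‖x + σ • y‖ ≤ m + σ * d := by
    have e : x + σ • y = ((1 + σ) / 2) • (x + y) + ((1 - σ) / 2) • (x - y) := by module
    rw [e]
    refine (norm_add_le _ _).trans (le_of_eq ?_)
    rw [norm_smul, norm_smul, Real.norm_of_nonneg (by linarith), Real.norm_of_nonneg (by linarith)]
    ring
  have h2 : ‖x - σ • y‖ ≤ m - σ * d := by
    have e : x - σ • y = ((1 - σ) / 2) • (x + y) + ((1 + σ) / 2) • (x - y) := by module
    rw [e]
    refine (norm_add_le _ _).trans (le_of_eq ?_)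
    rw [norm_smul, norm_smul, Real.norm_of_nonneg (by linarith), Real.norm_of_nonneg (by linarith)]
    ring
  have e3 : (‖x + y‖ ^ 2 + ‖x - y‖ ^ 2) / 2 = (m ^ 2 + σ ^ 2 * d ^ 2) + (1 - σ ^ 2) * d ^ 2 := by
    rw [hm, hd]; ring
  -- Here `P ± Q = (m ± σ d) ^ 2`, and `c` is what is missing from `P` to `m ^ 2 + d ^ 2`.
  have h4 := add_pow_add_sub_pow_le (P := m ^ 2 + σ ^ 2 * d ^ 2) (Q := 2 * σ * m * d)
    (c := (1 - σ ^ 2) * d ^ 2) (δ := (L : ℝ)⁻¹) (by positivity)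
    (mul_nonneg (by nlinarith) (sq_nonneg d)) (by positivity) (by
      have h5 : 4 * σ ^ 2 ≤ (L : ℝ)⁻¹ * (1 - σ ^ 2) := by
        have h6 : (L : ℝ)⁻¹ = 4 * σ := by rw [hσ]; field_simp
        rw [h6]
        nlinarith
      calc (2 * σ * m * d) ^ 2 = 4 * σ ^ 2 * (m ^ 2 * d ^ 2) := by ring
        _ ≤ (L : ℝ)⁻¹ * (1 - σ ^ 2) * (m ^ 2 * d ^ 2) :=
            mul_le_mul_of_nonneg_right h5 (by positivity)
        _ ≤ (L : ℝ)⁻¹ * (1 - σ ^ 2) * ((m ^ 2 + σ ^ 2 * d ^ 2) * d ^ 2) := by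
            refine mul_le_mul_of_nonneg_left ?_ (mul_nonneg (by positivity) (by nlinarith))
            refine mul_le_mul_of_nonneg_right ?_ (sq_nonneg d)
            nlinarith [mul_nonneg (sq_nonneg σ) (sq_nonneg d)]
        _ = _ := by ring)
    (L := L) (by rw [mul_inv_cancel₀ (by positivity)])
  rw [e3]
  refine le_trans (add_le_add (pow_le_pow_left₀ (norm_nonneg _) h1 _)
    (pow_le_pow_left₀ (norm_nonneg _) h2 _)) (le_trans (le_of_eq ?_) h4)
  rw [pow_mul, pow_mul]
  congr 2 <;> ring

/-- Hypercontractivity tensorizes: the two-point inequality handles one sign, and Minkowski's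
inequality interchanges it with the average over the others. The offset `h` carries the signs
already conditioned on. -/
theorem signAvg_norm_pow_le {L : ℕ} (hL : L ≠ 0) {n : ℕ} (h : F) (x : Fin n → F) :
    signAvg n (fun e => ‖h + (4 * (L : ℝ))⁻¹ • ∑ i, e i • x i‖ ^ (2 * L))
      ≤ signAvg n (fun e => ‖h + ∑ i, e i • x i‖ ^ 2) ^ L := by
  induction n generalizing h with
  | zero => simp [signAvg_zero, pow_mul]
  | succ n ih =>
    set σ : ℝ := (4 * (L : ℝ))⁻¹ with hσ
    simp only [signAvg_succ, Fin.sum_univ_succ, Fin.cons_zero, Fin.cons_succ]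
    have step : ∀ c : ℝ,
        signAvg n (fun e => ‖h + σ • (c • x 0 + ∑ i, e i • x i.succ)‖ ^ (2 * L))
          ≤ signAvg n (fun e => ‖h + (σ * c) • x 0 + ∑ i, e i • x i.succ‖ ^ 2) ^ L := by
      intro c
      simpa only [smul_add, smul_smul, add_assoc] using
        ih (h + (σ * c) • x 0) (fun i => x i.succ)
    -- The induction hypothesis has removed `σ` from the last `n` signs; this removes it from the
    -- first.
    have hmink := signAvg_pow_add_pow_le (L := L)
      (a := fun e => ‖h + (σ * 1) • x 0 + ∑ i, e i • x i.succ‖ ^ 2)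
      (b := fun e => ‖h + (σ * -1) • x 0 + ∑ i, e i • x i.succ‖ ^ 2)
      (c := fun e => (‖h + ((1 : ℝ) • x 0 + ∑ i, e i • x i.succ)‖ ^ 2
        + ‖h + ((-1 : ℝ) • x 0 + ∑ i, e i • x i.succ)‖ ^ 2) / 2)
      (fun _ => by positivity) (fun _ => by positivity) (fun _ => by positivity) hL (by
        intro e
        have := norm_two_point_le hL (h + ∑ i, e i • x i.succ) (x 0)
        rw [← hσ] at this
        have e1 : h + (σ * 1) • x 0 + ∑ i, e i • x i.succ
            = h + ∑ i, e i • x i.succ + σ • x 0 := by module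
        have e2 : h + (σ * -1) • x 0 + ∑ i, e i • x i.succ
            = h + ∑ i, e i • x i.succ - σ • x 0 := by module
        have e3 : h + ((1 : ℝ) • x 0 + ∑ i, e i • x i.succ)
            = h + ∑ i, e i • x i.succ + x 0 := by module
        have e4 : h + ((-1 : ℝ) • x 0 + ∑ i, e i • x i.succ)
            = h + ∑ i, e i • x i.succ - x 0 := by module
        simp only [e1, e2, e3, e4, ← pow_mul]
        exact this)
    have e5 : signAvg n (fun e => (‖h + ((1 : ℝ) • x 0 + ∑ i, e i • x i.succ)‖ ^ 2
        + ‖h + ((-1 : ℝ) • x 0 + ∑ i, e i • x i.succ)‖ ^ 2) / 2)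
        = (signAvg n (fun e => ‖h + ((1 : ℝ) • x 0 + ∑ i, e i • x i.succ)‖ ^ 2)
          + signAvg n (fun e => ‖h + ((-1 : ℝ) • x 0 + ∑ i, e i • x i.succ)‖ ^ 2)) / 2 := by
      rw [← signAvg_add, div_eq_inv_mul, ← signAvg_const_mul]
      simp only [div_eq_inv_mul]
    rw [e5] at hmink
    linarith [step 1, step (-1)]

theorem signAvg_sq_le {n : ℕ} (f g : (Fin n → ℝ) → ℝ) :
    signAvg n (fun e => f e * g e) ^ 2
      ≤ signAvg n (fun e => f e ^ 2) * signAvg n fun e => g e ^ 2 := by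
  simp only [signAvg, mul_pow]
  have := Finset.sum_mul_sq_le_sq_mul_sq (Finset.univ : Finset (Fin n → Bool))
    (fun ε => f fun j => boolSign (ε j)) fun ε => g fun j => boolSign (ε j)
  calc _ ≤ (((2 : ℝ) ^ n)⁻¹) ^ 2 * _ := mul_le_mul_of_nonneg_left this (by positivity)
    _ = _ := by ring

/-- Reverse Hölder inequality from first to second moments. -/
theorem signAvg_norm_sq_le {n : ℕ} (x : Fin n → F) :
    signAvg n (fun e => ‖∑ i, e i • x i‖ ^ 2)
      ≤ (64 * signAvg n fun e => ‖∑ i, e i • x i‖) ^ 2 := by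
  set m : ℕ → ℝ := fun j => signAvg n fun e => ‖∑ i, e i • x i‖ ^ j with hm
  have hm0 : ∀ j, 0 ≤ m j := fun j => signAvg_nonneg fun e => by positivity
  -- Hypercontractivity with `L = 2`, where `4096 = 8 ^ 4`. Two Cauchy–Schwarz inequalities then
  -- give `m₂ ^ 4 ≤ m₁² m₂ m₄ ≤ 4096 m₁² m₂³`, and `64 = √4096`.
  have h4 : m 4 ≤ 4096 * m 2 ^ 2 := by
    have := signAvg_norm_pow_le (L := 2) two_ne_zero 0 x
    simp only [zero_add, norm_smul, mul_pow, signAvg_const_mul] at this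
    norm_num at this
    change 1 / 4096 * m 4 ≤ m 2 ^ 2 at this
    linarith
  have h2 : m 2 ^ 2 ≤ m 1 * m 3 := by
    have := signAvg_sq_le (n := n) (fun e => √‖∑ i, e i • x i‖)
      fun e => √‖∑ i, e i • x i‖ * ‖∑ i, e i • x i‖
    simp only [← mul_assoc, Real.mul_self_sqrt (norm_nonneg _), mul_pow,
      Real.sq_sqrt (norm_nonneg _)] at this
    simpa only [hm, pow_one, ← pow_succ', ← sq] using this
  have h3 : m 3 ^ 2 ≤ m 2 * m 4 := by
    have := signAvg_sq_le (n := n) (fun e => ‖∑ i, e i • x i‖) fun e => ‖∑ i, e i • x i‖ ^ 2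
    simp only [← pow_mul, ← pow_succ'] at this
    exact this
  have e1 : signAvg n (fun e => ‖∑ i, e i • x i‖) = m 1 := by simp [hm]
  rw [e1]
  change m 2 ≤ _
  rcases (hm0 2).eq_or_lt with h0 | h0
  · rw [← h0]; positivity
  have h5 : m 3 ^ 2 ≤ 4096 * m 2 ^ 3 := by
    nlinarith [mul_le_mul_of_nonneg_left h4 h0.le]
  have h6 : m 2 ^ 3 * m 2 ≤ m 2 ^ 3 * (64 * m 1) ^ 2 := by
    calc m 2 ^ 3 * m 2 = (m 2 ^ 2) ^ 2 := by ring
      _ ≤ (m 1 * m 3) ^ 2 := pow_le_pow_left₀ (by positivity) h2 2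
      _ = m 1 ^ 2 * m 3 ^ 2 := by ring
      _ ≤ m 1 ^ 2 * (4096 * m 2 ^ 3) := mul_le_mul_of_nonneg_left h5 (sq_nonneg _)
      _ = _ := by ring
  exact le_of_mul_le_mul_left h6 (by positivity)

end Hypercontractivity

/-! ### Rademacher families -/

section Rademacher

theorem boolSign_injective : Function.Injective boolSign := by
  intro a b h
  cases a <;> cases b <;> first | rfl | (norm_num [boolSign] at h)

namespace IsRademacherFamily

variable {Ω : Type*} [MeasurableSpace Ω] {P : Measure Ω} {r : ℕ → Ω → ℝ}

theorem measure_eq_boolSign (hr : IsRademacherFamily P r) (j : ℕ) (b : Bool) :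
    P (r j ⁻¹' {boolSign b}) = 1 / 2 := by
  cases b
  · exact hr.measure_neg_one j
  · exact hr.measure_one j

theorem measure_eq_sign_vector (hr : IsRademacherFamily P r) {n : ℕ} (ε : Fin n → Bool) :
    P {ω | ∀ j : Fin n, r j ω = boolSign (ε j)} = (2 ^ n)⁻¹ := by
  have h := (hr.indep.precomp (g := fun j : Fin n => (j : ℕ))
    Fin.val_injective).measure_inter_preimage_eq_mul Finset.univ
    (sets := fun j => {boolSign (ε j)}) fun j _ => measurableSet_singleton _
  simp only [Finset.mem_univ, Set.iInter_true, hr.measure_eq_boolSign,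
    Finset.prod_const, Finset.card_univ, Fintype.card_fin] at h
  rw [ENNReal.inv_pow, ← one_div, ← h]
  congr 1
  ext ω
  simp

/-- The first `n` signs are uniform on the cube, so every Rademacher family yields the same finite
average. Factoring through the finite space `Fin n → Bool` makes measurability of `Φ` irrelevant. -/
theorem integral_eq_signAvg [IsProbabilityMeasure P] (hr : IsRademacherFamily P r)
    {n : ℕ} (Φ : (Fin n → ℝ) → ℝ) :
    ∫ ω, Φ (fun j => r j ω) ∂P = signAvg n Φ := by
  classical
  set R : Ω → Fin n → Bool := fun ω j => decide (r j ω = 1) with hR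
  have hRm : Measurable R := measurable_pi_iff.2 fun j =>
    measurable_to_bool (by
      have : (fun ω => decide (r j ω = 1)) ⁻¹' {true} = r j ⁻¹' {1} := by ext; simp
      rw [this]
      exact hr.measurable j (measurableSet_singleton 1))
  have hsign : ∀ ω (j : Fin n), boolSign (R ω j) = r j ω := by
    intro ω j
    rcases hr.eq_or_eq j ω with h | h <;> simp [hR, boolSign, h]
    norm_num
  have hfib : ∀ ε, P.map R {ε} = (2 ^ n)⁻¹ := by
    intro ε
    rw [Measure.map_apply hRm (measurableSet_singleton ε), ← hr.measure_eq_sign_vector ε]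
    congr 1
    ext ω
    simp only [Set.mem_preimage, Set.mem_singleton_iff, Set.mem_ofPred_eq, ← hsign]
    exact ⟨fun h j => by rw [h], fun h => funext fun j => boolSign_injective (h j)⟩
  have : IsProbabilityMeasure (P.map R) := Measure.isProbabilityMeasure_map hRm.aemeasurable
  calc ∫ ω, Φ (fun j => r j ω) ∂P
      = ∫ ω, (fun ε : Fin n → Bool => Φ fun j => boolSign (ε j)) (R ω) ∂P := by
        simp only [hsign]
    _ = ∫ ε, Φ (fun j => boolSign (ε j)) ∂(P.map R) :=
        (integral_map (f := fun ε : Fin n → Bool => Φ fun j => boolSign (ε j)) hRm.aemeasurable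
          (measurable_of_finite _).aestronglyMeasurable).symm
    _ = signAvg n Φ := by
        rw [integral_fintype .of_finite]
        simp [measureReal_def, hfib, signAvg, Finset.mul_sum]

variable {F : Type*} [NormedAddCommGroup F] [NormedSpace ℝ F]

theorem stronglyMeasurable_sum (hr : IsRademacherFamily P r) {n : ℕ} (x : Fin n → F) :
    StronglyMeasurable fun ω => ∑ j : Fin n, r j ω • x j :=
  Finset.stronglyMeasurable_fun_sum _ fun j _ =>
    (hr.measurable j).stronglyMeasurable.smul_const (x j)

theorem memLp_sum [IsProbabilityMeasure P] (hr : IsRademacherFamily P r)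
    {n : ℕ} (x : Fin n → F) (s : ℝ≥0∞) :
    MemLp (fun ω => ∑ j : Fin n, r j ω • x j) s P := by
  refine MemLp.of_bound (hr.stronglyMeasurable_sum x).aestronglyMeasurable (∑ j, ‖x j‖)
    (.of_forall fun ω => (norm_sum_le _ _).trans (Finset.sum_le_sum fun j _ => ?_))
  rw [norm_smul]
  rcases hr.eq_or_eq j ω with h | h <;> simp [h]

theorem lpNorm_sum_eq [IsProbabilityMeasure P] (hr : IsRademacherFamily P r)
    {n : ℕ} (x : Fin n → F) {s : ℝ} (hs : 0 < s) :
    lpNorm (fun ω => ∑ j : Fin n, r j ω • x j) (ENNReal.ofReal s) P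
      = signAvg n (fun e => ‖∑ j, e j • x j‖ ^ s) ^ (1 / s) := by
  rw [lpNorm_eq_integral_norm_rpow_toReal (by simpa using hs) (by simp)
    (hr.stronglyMeasurable_sum x).aestronglyMeasurable, ENNReal.toReal_ofReal hs.le, one_div,
    ← hr.integral_eq_signAvg]

theorem lpNorm_sum_mono [IsProbabilityMeasure P] (hr : IsRademacherFamily P r)
    {n : ℕ} (x : Fin n → F) {s t : ℝ}
    (hst : s ≤ t) :
    lpNorm (fun ω => ∑ j : Fin n, r j ω • x j) (ENNReal.ofReal s) P
      ≤ lpNorm (fun ω => ∑ j : Fin n, r j ω • x j) (ENNReal.ofReal t) P := by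
  have hm := (hr.stronglyMeasurable_sum x).aestronglyMeasurable (μ := P)
  rw [← toReal_eLpNorm hm, ← toReal_eLpNorm hm]
  exact ENNReal.toReal_mono (hr.memLp_sum x _).eLpNorm_ne_top
    (eLpNorm_le_eLpNorm_of_exponent_le (ENNReal.ofReal_le_ofReal hst) hm)

/-- Kahane's inequality, with a constant independent of the normed space. -/
theorem lpNorm_sum_le_lpNorm_sum [IsProbabilityMeasure P] (hr : IsRademacherFamily P r)
    {n : ℕ} (x : Fin n → F) {p q : ℝ}
    (hp : 1 ≤ p) {L : ℕ} (hL : L ≠ 0) (hq : q ≤ 2 * L) :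
    lpNorm (fun ω => ∑ j : Fin n, r j ω • x j) (ENNReal.ofReal q) P
      ≤ 4 * L * 64 * lpNorm (fun ω => ∑ j : Fin n, r j ω • x j) (ENNReal.ofReal p) P := by
  have hL1 : (0 : ℝ) < L := by exact_mod_cast Nat.pos_of_ne_zero hL
  -- Monotonicity of `L_s` norms reduces the claim to exponents `2L` and `1`.
  refine (hr.lpNorm_sum_mono x hq).trans ?_
  refine le_trans ?_ (mul_le_mul_of_nonneg_left (hr.lpNorm_sum_mono x hp) (by positivity))
  rw [hr.lpNorm_sum_eq x (by positivity), hr.lpNorm_sum_eq x one_pos]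
  simp only [Real.rpow_one, div_one]
  have hn1 : 0 ≤ signAvg n fun e => ‖∑ j, e j • x j‖ := signAvg_nonneg fun _ => norm_nonneg _
  have h1 := signAvg_norm_pow_le hL 0 x
  simp only [zero_add, norm_smul, mul_pow, signAvg_const_mul] at h1
  rw [Real.norm_of_nonneg (by positivity), inv_pow, inv_mul_le_iff₀ (by positivity)] at h1
  -- The factor `4L` undoes the damping in the hypercontractive bound; `64` comes from passing from
  -- second to first moments.
  have h2 : signAvg n (fun e => ‖∑ j, e j • x j‖ ^ (2 * (L : ℝ)))
      ≤ (4 * L * 64 * signAvg n fun e => ‖∑ j, e j • x j‖) ^ (2 * (L : ℝ)) := by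
    have e : (2 * (L : ℝ)) = ((2 * L : ℕ) : ℝ) := by push_cast; rfl
    simp only [e, Real.rpow_natCast]
    refine h1.trans ?_
    calc (4 * (L : ℝ)) ^ (2 * L) * signAvg n (fun e => ‖∑ i, e i • x i‖ ^ 2) ^ L
        ≤ (4 * (L : ℝ)) ^ (2 * L) * ((64 * signAvg n fun e => ‖∑ i, e i • x i‖) ^ 2) ^ L :=
          mul_le_mul_of_nonneg_left (pow_le_pow_left₀ (signAvg_nonneg fun _ => by positivity)
            (signAvg_norm_sq_le x) L) (by positivity)
      _ = _ := by rw [← pow_mul, ← mul_pow]; ring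
  calc _ ≤ ((4 * L * 64 * signAvg n fun e => ‖∑ j, e j • x j‖) ^ (2 * (L : ℝ)))
        ^ (1 / (2 * (L : ℝ))) :=
        Real.rpow_le_rpow (signAvg_nonneg fun _ => by positivity) h2 (by positivity)
    _ = _ := by
        rw [← Real.rpow_mul (by positivity), mul_one_div_cancel (by positivity), Real.rpow_one]

end IsRademacherFamily

theorem IsRademacherFamily.completion {Ω : Type*} [MeasurableSpace Ω] {P : Measure Ω}
    {r : ℕ → Ω → ℝ} (hr : IsRademacherFamily P r) :
    IsRademacherFamily (Ω := NullMeasurableSpace Ω P) P.completion r where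
  measurable j _ hs := (hr.measurable j hs).nullMeasurableSet
  eq_or_eq := hr.eq_or_eq
  measure_neg_one := hr.measure_neg_one
  measure_one := hr.measure_one
  indep := iIndepFun_iff_measure_inter_preimage_eq_mul.2 fun S _ hs =>
    hr.indep.measure_inter_preimage_eq_mul S hs

/-- Rademacher families on complete probability spaces exist. -/
theorem exists_isRademacherFamily :
    ∃ (Ω : Type) (_ : MeasurableSpace Ω) (P : Measure Ω) (_ : IsProbabilityMeasure P)
      (_ : P.IsComplete) (r : ℕ → Ω → ℝ), IsRademacherFamily P r := by
  have hprob : IsProbabilityMeasure (PMF.uniformOfFintype Bool).toMeasure := inferInstance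
  set ν : Measure Bool := (PMF.uniformOfFintype Bool).toMeasure with hν
  have hνb : ∀ b : Bool, ν {b} = 1 / 2 := by
    intro b
    rw [hν, PMF.toMeasure_apply_singleton _ _ (measurableSet_singleton b)]
    simp
  set Q : Measure (ℕ → Bool) := Measure.infinitePi fun _ => ν with hQ
  have hm : ∀ j : ℕ, Measurable fun ω : ℕ → Bool => boolSign (ω j) := fun j =>
    (measurable_of_finite boolSign).comp (measurable_pi_apply j)
  have hcoord : ∀ (j : ℕ) (b : Bool), Q {ω | ω j = b} = 1 / 2 := by
    intro j b
    have h := (measurePreserving_eval_infinitePi (fun _ : ℕ => ν) j).measure_preimage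
      (measurableSet_singleton b).nullMeasurableSet
    rw [hνb] at h
    exact h
  have hind : iIndepFun (fun (j : ℕ) (ω : ℕ → Bool) => boolSign (ω j)) Q :=
    iIndepFun_infinitePi (P := fun _ : ℕ => ν) (X := fun _ => boolSign)
      fun _ => measurable_of_finite _
  have hr : IsRademacherFamily Q fun j ω => boolSign (ω j) := by
    refine ⟨hm, fun j ω => ?_, fun j => ?_, fun j => ?_, hind⟩
    · cases ω j <;> simp [boolSign]
    · rw [← hcoord j false]
      exact congrArg Q (Set.ext fun ω => boolSign_injective.eq_iff (b := false))
    · rw [← hcoord j true]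
      exact congrArg Q (Set.ext fun ω => boolSign_injective.eq_iff (b := true))
  exact ⟨NullMeasurableSpace (ℕ → Bool) Q, inferInstance, Q.completion, ⟨measure_univ (μ := Q)⟩,
    inferInstance, _, hr.completion⟩

variable {F : Type*} [NormedAddCommGroup F] [NormedSpace ℝ F]

theorem typeConstant_nonneg (p : ℝ) : 0 ≤ typeConstant F p :=
  Real.sInf_nonneg fun _ h => h.1.le

theorem khintchineConstant_nonneg (q : ℝ) : 0 ≤ khintchineConstant q :=
  Real.sInf_nonneg fun _ h => h.1.le

universe u

theorem kahaneKhintchineConstant_nonneg (q p : ℝ) : 0 ≤ kahaneKhintchineConstant.{u} q p :=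
  Real.sInf_nonneg fun _ h => h.1.le

/-- Makes the infimum itself an admissible constant. Nonemptiness is essential since `sInf ∅ = 0`.
-/
theorem le_sInf_mul {s : Set ℝ} (hs : s.Nonempty) {a b : ℝ} (hb : 0 ≤ b)
    (h : ∀ c ∈ s, a ≤ c * b) : a ≤ sInf s * b := by
  rcases hb.eq_or_lt with h0 | h0
  · obtain ⟨c, hc⟩ := hs
    simpa [← h0] using h c hc
  · rw [← div_le_iff₀ h0]
    exact le_csInf hs fun c hc => (div_le_iff₀ h0).2 (h c hc)

theorem signAvg_norm_rpow_le_typeConstant {p : ℝ} (hp : 1 ≤ p) (hF : HasRademacherType F p)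
    {n : ℕ} (x : Fin n → F) :
    signAvg n (fun e => ‖∑ j, e j • x j‖ ^ p) ^ (1 / p)
      ≤ typeConstant F p * (∑ j, ‖x j‖ ^ p) ^ (1 / p) := by
  obtain ⟨Ω, _, P, _, _, r, hr⟩ := exists_isRademacherFamily
  rw [← hr.lpNorm_sum_eq x (by linarith)]
  refine le_sInf_mul hF ?_ fun τ hτ => hτ.2 Ω P r hr n x
  exact Real.rpow_nonneg (Finset.sum_nonneg fun j _ => Real.rpow_nonneg (norm_nonneg _) _) _

theorem signAvg_norm_rpow_le_kahaneKhintchineConstant {F : Type u} [NormedAddCommGroup F]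
    [NormedSpace ℝ F] [CompleteSpace F] {p q : ℝ} (hp : 1 ≤ p) (hpq : p ≤ q) {n : ℕ}
    (x : Fin n → F) :
    signAvg n (fun e => ‖∑ j, e j • x j‖ ^ q) ^ (1 / q)
      ≤ kahaneKhintchineConstant.{u} q p * signAvg n (fun e => ‖∑ j, e j • x j‖ ^ p) ^ (1 / p) := by
  obtain ⟨Ω, _, P, _, _, r, hr⟩ := exists_isRademacherFamily
  rw [← hr.lpNorm_sum_eq x (by linarith), ← hr.lpNorm_sum_eq x (by linarith)]
  refine le_sInf_mul ?_ lpNorm_nonneg fun K hK => hK.2 Ω P r hr F n x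
  -- Kahane's inequality exhibits an admissible constant, uniform over all spaces and families.
  obtain ⟨L, hL⟩ := exists_nat_gt q
  have hL0 : (0 : ℝ) < L := by linarith
  refine ⟨4 * L * 64, by positivity, fun Ω _ P _ _ r hr F _ _ _ n x => ?_⟩
  exact hr.lpNorm_sum_le_lpNorm_sum x hp (by rintro rfl; simp at hL0) (by linarith)

/-- The combination of Kahane's inequality and the type inequality. -/
theorem signAvg_norm_rpow_le {F : Type u} [NormedAddCommGroup F]
    [NormedSpace ℝ F] [CompleteSpace F] {p q : ℝ} (hp : 1 ≤ p) (hpq : p ≤ q)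
    (hF : HasRademacherType F p) {n : ℕ} (x : Fin n → F) :
    signAvg n (fun e => ‖∑ j, e j • x j‖ ^ q)
      ≤ (kahaneKhintchineConstant.{u} q p * typeConstant F p) ^ q
        * (∑ j, ‖x j‖ ^ p) ^ (q / p) := by
  have hq : 0 < q := by linarith
  have hK := kahaneKhintchineConstant_nonneg.{u} q p
  have hτ := typeConstant_nonneg (F := F) p
  have hS : 0 ≤ ∑ j, ‖x j‖ ^ p := Finset.sum_nonneg fun j _ => Real.rpow_nonneg (norm_nonneg _) _
  have hA : 0 ≤ signAvg n fun e => ‖∑ j, e j • x j‖ ^ q :=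
    signAvg_nonneg fun _ => Real.rpow_nonneg (norm_nonneg _) _
  have h := (signAvg_norm_rpow_le_kahaneKhintchineConstant hp hpq x).trans
    (mul_le_mul_of_nonneg_left (signAvg_norm_rpow_le_typeConstant hp hF x) hK)
  rw [← mul_assoc] at h
  have h2 := Real.rpow_le_rpow (Real.rpow_nonneg hA _) h hq.le
  rw [← Real.rpow_mul hA, one_div_mul_cancel hq.ne', Real.rpow_one,
    Real.mul_rpow (mul_nonneg hK hτ) (Real.rpow_nonneg hS _), ← Real.rpow_mul hS] at h2
  rwa [div_mul_eq_mul_div, one_mul] at h2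

end Rademacher

/-! ### Tensor powers in the injective tensor products -/

section TensorPower

variable {k : ℕ} {E : Type*} [NormedAddCommGroup E] [NormedSpace ℝ E]

theorem abs_dual_apply_le (f : Metric.closedBall (0 : StrongDual ℝ E) 1) (x : E) :
    |(f : StrongDual ℝ E) x| ≤ ‖x‖ := by
  have h : ‖(f : StrongDual ℝ E)‖ ≤ 1 := mem_closedBall_zero_iff.mp f.2
  exact ((f : StrongDual ℝ E).le_opNorm x).trans
    (mul_le_of_le_one_left (norm_nonneg x) h)

theorem norm_elemTensor_le (x : Fin k → E) : ‖elemTensor k E x‖ ≤ ∏ n, ‖x n‖ := by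
  refine ciSup_le fun f => ?_
  rw [tensorEval_elemTensor, Finset.abs_prod]
  exact Finset.prod_le_prod (fun _ _ => abs_nonneg _) fun n _ => abs_dual_apply_le (f n) (x n)

theorem norm_tensorPow_le (x : E) : ‖tensorPow k x‖ ≤ ‖x‖ ^ k := by
  rw [tensorPow, UniformSpace.Completion.norm_coe]
  simpa using norm_elemTensor_le fun _ : Fin k => x

variable (k E) in
theorem continuous_tensorPow : Continuous (tensorPow k : E → InjTensor k E) := by
  have h : Continuous (elemTensor k E) :=
    ((elemTensor k E).mkContinuous 1 fun x => by simpa using norm_elemTensor_le x).cont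
  exact (UniformSpace.Completion.continuous_coe _).comp
    (h.comp (continuous_pi fun _ => continuous_id))

variable (k E) in
theorem continuous_symTensorPow : Continuous (symTensorPow k : E → SymInjTensor k E) := by
  have h : (symTensorPow k : E → SymInjTensor k E) = fun x => symProj k E (tensorPow k x) :=
    funext fun x => (symProj_tensorPow x).symm
  rw [h]
  exact (symProj k E).continuous.comp (continuous_tensorPow k E)

theorem tensorEval_symElemPow (f : StrongDual ℝ E) (x : E) :
    tensorEval (fun _ => f) (symInclusion k E (symElemPow k x)) = f x ^ k := by
  refine (tensorEval_elemTensor (fun _ => f) fun _ => x).trans ?_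
  simp

/-- The bridge from tensors to the contraction principle: the embedding into the completion is
isometric, and only diagonal functionals `f ⊗ ⋯ ⊗ f` are tested. -/
theorem norm_sum_smul_symTensorPow {n : ℕ} (c : Fin n → ℝ) (x : Fin n → E) :
    ‖∑ j, c j • symTensorPow k (x j)‖
      = ⨆ f : Metric.closedBall (0 : StrongDual ℝ E) 1,
          |∑ j, c j * (f : StrongDual ℝ E) (x j) ^ k| := by
  have h : ∑ j, c j • symTensorPow k (x j)
      = UniformSpace.Completion.toComplₗᵢ (𝕜 := ℝ) (∑ j, c j • symElemPow k (x j)) := by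
    rw [map_sum]
    exact Finset.sum_congr rfl fun j _ =>
      ((UniformSpace.Completion.toComplₗᵢ (𝕜 := ℝ)).map_smul (c j) (symElemPow k (x j))).symm
  rw [h, LinearIsometry.norm_map, symAlgTensor_norm_def]
  simp only [map_sum, map_smul, tensorEval_symElemPow, smul_eq_mul]

/-- From the factorization of `a ^ k - b ^ k`. It serves both the Lipschitz condition of the
contraction principle and the comparison of two moments. -/
theorem abs_pow_sub_pow_le {a b x y d : ℝ} (ha : |a| ≤ x) (hb : |b| ≤ y) (hd : |a - b| ≤ d) :
    |a ^ k - b ^ k| ≤ d * ∑ i ∈ Finset.range k, x ^ i * y ^ (k - i - 1) := by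
  have hx : 0 ≤ x := (abs_nonneg a).trans ha
  have hd0 : 0 ≤ d := (abs_nonneg _).trans hd
  rw [← (Commute.all a b).mul_geom_sum₂ k, abs_mul]
  refine mul_le_mul hd ((Finset.abs_sum_le_sum_abs _ _).trans (Finset.sum_le_sum fun i _ => ?_))
    (abs_nonneg _) hd0
  rw [abs_mul, abs_pow, abs_pow, Nat.sub_right_comm]
  exact mul_le_mul (pow_le_pow_left₀ (abs_nonneg a) ha i) (pow_le_pow_left₀ (abs_nonneg b) hb _)
    (by positivity) (by positivity)

theorem norm_symTensorPow_sub_le (x y : E) :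
    ‖symTensorPow k x - symTensorPow k y‖
      ≤ ‖x - y‖ * ∑ i ∈ Finset.range k, ‖x‖ ^ i * ‖y‖ ^ (k - i - 1) := by
  have h : symTensorPow k x - symTensorPow k y
      = ∑ j : Fin 2, (![1, -1] : Fin 2 → ℝ) j • symTensorPow k ((![x, y] : Fin 2 → E) j) := by
    simp [Fin.sum_univ_two, sub_eq_add_neg]
  rw [h, norm_sum_smul_symTensorPow]
  refine ciSup_le fun f => ?_
  have h2 := abs_pow_sub_pow_le (k := k) (abs_dual_apply_le f x) (abs_dual_apply_le f y)
    (d := ‖x - y‖) (by rw [← map_sub]; exact abs_dual_apply_le f (x - y))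
  simpa [Fin.sum_univ_two, sub_eq_add_neg] using h2

theorem norm_symTensorPow_le (x : E) : ‖symTensorPow k x‖ ≤ ‖x‖ ^ k := by
  have h : symTensorPow k x = ∑ j : Fin 1, (1 : ℝ) • symTensorPow k x := by simp
  rw [h, norm_sum_smul_symTensorPow]
  refine ciSup_le fun f => ?_
  simpa [abs_pow] using pow_le_pow_left₀ (abs_nonneg _) (abs_dual_apply_le f x) k

/-- The Rademacher sums of tensor powers are controlled by Rademacher sums in `E`. -/
theorem signAvg_norm_symTensorPow_le {q : ℝ} (hq : 1 ≤ q) (hk : 0 < k) {n : ℕ} (x : Fin n → E) :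
    signAvg n (fun e => ‖∑ j, e j • symTensorPow k (x j)‖ ^ q)
      ≤ (2 * k) ^ q * signAvg n fun e => ‖∑ j, e j • ‖x j‖ ^ (k - 1) • x j‖ ^ q := by
  have hk1 : (1 : ℝ) ≤ k := by exact_mod_cast hk
  have hq0 : 0 ≤ q := by linarith
  simp only [norm_sum_smul_symTensorPow]
  -- The slope `k ‖xⱼ‖ ^ (k - 1)` is the Lipschitz constant of `t ↦ t ^ k` on `[-‖xⱼ‖, ‖xⱼ‖]`.
  have h := signAvg_iSup_abs_contraction (T := Metric.closedBall (0 : StrongDual ℝ E) 1) hq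
    (u := fun j f => k * (f : StrongDual ℝ E) (‖x j‖ ^ (k - 1) • x j))
    (v := fun j f => (f : StrongDual ℝ E) (x j) ^ k)
    (fun j => exists_abs_mul_le _ ⟨_, fun f => abs_dual_apply_le f _⟩)
    (fun j f => by
      rw [map_smul, smul_eq_mul, abs_mul, abs_mul, abs_pow, abs_pow, abs_norm, Nat.abs_cast]
      calc |(f : StrongDual ℝ E) (x j)| ^ k
          = 1 * (|(f : StrongDual ℝ E) (x j)| ^ (k - 1) * |(f : StrongDual ℝ E) (x j)|) := by
            rw [one_mul, ← pow_succ, Nat.sub_add_cancel hk]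
        _ ≤ k * (‖x j‖ ^ (k - 1) * |(f : StrongDual ℝ E) (x j)|) := by
            gcongr
            exact abs_dual_apply_le f (x j))
    (fun j f g => by
      refine (abs_pow_sub_pow_le (abs_dual_apply_le f (x j)) (abs_dual_apply_le g (x j))
        le_rfl).trans (le_of_eq ?_)
      have e : ∀ i ∈ Finset.range k, ‖x j‖ ^ i * ‖x j‖ ^ (k - i - 1) = ‖x j‖ ^ (k - 1) := by
        intro i hi
        rw [← pow_add]
        congr 1
        have := Finset.mem_range.1 hi
        omega
      rw [Finset.sum_congr rfl e, Finset.sum_const, Finset.card_range, nsmul_eq_mul, map_smul,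
        map_smul, smul_eq_mul, smul_eq_mul, ← mul_sub, ← mul_sub, abs_mul, abs_mul, abs_pow,
        abs_norm, Nat.abs_cast]
      ring)
  refine h.trans ?_
  rw [Real.mul_rpow (by norm_num) (by positivity), mul_assoc,
    ← signAvg_const_mul ((k : ℝ) ^ q)]
  refine mul_le_mul_of_nonneg_left (signAvg_mono fun e => ?_) (by positivity)
  rw [← Real.mul_rpow (by positivity) (norm_nonneg _)]
  refine Real.rpow_le_rpow (Real.iSup_nonneg fun _ => abs_nonneg _) (ciSup_le fun f => ?_) hq0
  -- The comparison process is linear in the vectors, so it is a single functional evaluated at a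
  -- Rademacher sum in `E`.
  have e1 : ∑ j, e j * (k * (f : StrongDual ℝ E) (‖x j‖ ^ (k - 1) • x j))
      = k * (f : StrongDual ℝ E) (∑ j, e j • ‖x j‖ ^ (k - 1) • x j) := by
    rw [map_sum, Finset.mul_sum]
    refine Finset.sum_congr rfl fun j _ => ?_
    rw [map_smul (f : StrongDual ℝ E) (e j), smul_eq_mul]
    ring
  rw [e1, abs_mul, Nat.abs_cast]
  exact mul_le_mul_of_nonneg_left (abs_dual_apply_le f _) (by positivity)

end TensorPower

/-! ### Moments -/

section Moments

variable {Ω : Type*} [MeasurableSpace Ω] {P : Measure Ω} {k : ℕ} {E : Type*}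
  [NormedAddCommGroup E] [NormedSpace ℝ E]

theorem integrable_tensorPow {ξ : Ω → E} (hk : k ≠ 0) (hξ : MemLp ξ k P) :
    Integrable (fun ω => tensorPow k (ξ ω)) P :=
  (hξ.integrable_norm_pow hk).mono'
    ((continuous_tensorPow k E).comp_aestronglyMeasurable hξ.1)
    (.of_forall fun ω => norm_tensorPow_le (ξ ω))

theorem integrable_symTensorPow {ξ : Ω → E} (hk : k ≠ 0) (hξ : MemLp ξ k P) :
    Integrable (fun ω => symTensorPow k (ξ ω)) P :=
  (hξ.integrable_norm_pow hk).mono'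
    ((continuous_symTensorPow k E).comp_aestronglyMeasurable hξ.1)
    (.of_forall fun ω => norm_symTensorPow_le (ξ ω))

theorem symMoment_eq_integral {ξ : Ω → E} (hk : k ≠ 0) (hξ : MemLp ξ k P) :
    symMoment k ξ P = ∫ ω, symTensorPow k (ξ ω) ∂P := by
  rw [symMoment, injMoment, ← (symProj k E).integral_comp_comm (integrable_tensorPow hk hξ)]
  simp only [symProj_tensorPow]

/-- Hölder's inequality for the `k`-th powers of three functions, with weights `1 / k`, `i / k`, `j
/ k` summing to one. -/
theorem lintegral_mul_pow_mul_pow_le {a b c : Ω → ℝ≥0∞} (ha : AEMeasurable a P)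
    (hb : AEMeasurable b P) (hc : AEMeasurable c P) {i j : ℕ} (hk : i + j + 1 = k) :
    ∫⁻ ω, a ω * (b ω ^ i * c ω ^ j) ∂P
      ≤ (∫⁻ ω, a ω ^ k ∂P) ^ (1 / (k : ℝ)) * (((∫⁻ ω, b ω ^ k ∂P) ^ (1 / (k : ℝ))) ^ i
        * ((∫⁻ ω, c ω ^ k ∂P) ^ (1 / (k : ℝ))) ^ j) := by
  have hk0 : (0 : ℝ) < k := by exact_mod_cast (by omega : 0 < k)
  have h := ENNReal.lintegral_prod_norm_pow_le (μ := P) (Finset.univ : Finset (Fin 3))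
    (f := ![fun ω => a ω ^ k, fun ω => b ω ^ k, fun ω => c ω ^ k])
    (p := ![1 / (k : ℝ), i / (k : ℝ), j / (k : ℝ)])
    (by
      intro l _
      fin_cases l
      · exact ha.pow_const k
      · exact hb.pow_const k
      · exact hc.pow_const k)
    (by
      simp only [Fin.sum_univ_three, Matrix.cons_val]
      rw [← add_div, ← add_div, div_eq_one_iff_eq hk0.ne', ← hk]
      push_cast
      ring)
    (by
      intro l _
      fin_cases l <;> simp <;> positivity)
  simp only [Fin.prod_univ_three, Matrix.cons_val] at h
  have hpow : ∀ (z : ℝ≥0∞) (m : ℕ), (z ^ k) ^ ((m : ℝ) / k) = z ^ m := by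
    intro z m
    rw [← ENNReal.rpow_natCast z k, ← ENNReal.rpow_mul, mul_div_cancel₀ _ hk0.ne',
      ENNReal.rpow_natCast]
  have hpow' : ∀ (z : ℝ≥0∞) (m : ℕ), z ^ ((m : ℝ) / k) = (z ^ (1 / (k : ℝ))) ^ m := by
    intro z m
    rw [← ENNReal.rpow_natCast, ← ENNReal.rpow_mul, one_div_mul_eq_div]
  have h1 : ∀ z : ℝ≥0∞, (z ^ k) ^ (1 / (k : ℝ)) = z := fun z => by
    simpa using hpow z 1
  simp only [hpow, h1, hpow', mul_assoc] at h
  exact h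

theorem eLpNorm_natCast_eq {F : Type*} [NormedAddCommGroup F] (hk : k ≠ 0) (f : Ω → F) :
    eLpNorm f k P = (∫⁻ ω, ‖f ω‖ₑ ^ k ∂P) ^ (1 / (k : ℝ)) := by
  rw [eLpNorm_eq_lintegral_rpow_enorm_toReal (by exact_mod_cast hk) (ENNReal.natCast_ne_top k)]
  simp

/-- Pull the norm inside the integral, use the pointwise bound, and apply Hölder to each term.
Extended nonnegative reals avoid integrability questions for the products. -/
theorem norm_symMoment_sub_le {η ξ : Ω → E} (hk : k ≠ 0) (hη : MemLp η k P) (hξ : MemLp ξ k P) :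
    ‖symMoment k η P - symMoment k ξ P‖
      ≤ lpNorm (η - ξ) k P
        * ∑ i ∈ Finset.range k, lpNorm η k P ^ i * lpNorm ξ k P ^ (k - i - 1) := by
  have hnn : ∀ i, 0 ≤ lpNorm η k P ^ i * lpNorm ξ k P ^ (k - i - 1) := fun i =>
    mul_nonneg (pow_nonneg lpNorm_nonneg _) (pow_nonneg lpNorm_nonneg _)
  have hint : ∫⁻ ω, ‖symTensorPow k (η ω) - symTensorPow k (ξ ω)‖ₑ ∂P
      ≤ ∑ i ∈ Finset.range k,
        eLpNorm (η - ξ) k P * (eLpNorm η k P ^ i * eLpNorm ξ k P ^ (k - i - 1)) := by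
    calc ∫⁻ ω, ‖symTensorPow k (η ω) - symTensorPow k (ξ ω)‖ₑ ∂P
        ≤ ∫⁻ ω, ∑ i ∈ Finset.range k,
            ‖(η - ξ) ω‖ₑ * (‖η ω‖ₑ ^ i * ‖ξ ω‖ₑ ^ (k - i - 1)) ∂P := by
          refine lintegral_mono fun ω => ?_
          rw [← Finset.mul_sum]
          simp only [← ofReal_norm, ← ENNReal.ofReal_pow (norm_nonneg _)]
          have h1 : ∀ i ∈ Finset.range k,
              ENNReal.ofReal (‖η ω‖ ^ i) * ENNReal.ofReal (‖ξ ω‖ ^ (k - i - 1))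
                = ENNReal.ofReal (‖η ω‖ ^ i * ‖ξ ω‖ ^ (k - i - 1)) := fun i _ =>
            (ENNReal.ofReal_mul (by positivity)).symm
          rw [Finset.sum_congr rfl h1, ← ENNReal.ofReal_sum_of_nonneg fun i _ => by positivity,
            ← ENNReal.ofReal_mul (norm_nonneg _)]
          exact ENNReal.ofReal_le_ofReal (norm_symTensorPow_sub_le (η ω) (ξ ω))
      _ = ∑ i ∈ Finset.range k, ∫⁻ ω,
            ‖(η - ξ) ω‖ₑ * (‖η ω‖ₑ ^ i * ‖ξ ω‖ₑ ^ (k - i - 1)) ∂P := by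
          refine lintegral_finsetSum' _ fun i _ => ?_
          exact (hη.1.sub hξ.1).enorm.mul ((hη.1.enorm.pow_const i).mul (hξ.1.enorm.pow_const _))
      _ ≤ _ := by
          refine Finset.sum_le_sum fun i hi => ?_
          have hik : i + (k - i - 1) + 1 = k := by
            have := Finset.mem_range.1 hi
            omega
          simp only [eLpNorm_natCast_eq hk]
          exact lintegral_mul_pow_mul_pow_le (hη.1.sub hξ.1).enorm hη.1.enorm hξ.1.enorm hik
  rw [symMoment_eq_integral hk hη, symMoment_eq_integral hk hξ,
    ← integral_sub (integrable_symTensorPow hk hη) (integrable_symTensorPow hk hξ),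
    ← ENNReal.ofReal_le_ofReal_iff
      (mul_nonneg lpNorm_nonneg (Finset.sum_nonneg fun i _ => hnn i)), ofReal_norm]
  refine (enorm_integral_le_lintegral_enorm _).trans (hint.trans (le_of_eq ?_))
  rw [← Finset.mul_sum, ENNReal.ofReal_mul lpNorm_nonneg, ofReal_lpNorm (hη.sub hξ),
    ENNReal.ofReal_sum_of_nonneg fun i _ => hnn i]
  congr 1
  refine Finset.sum_congr rfl fun i _ => ?_
  rw [ENNReal.ofReal_mul (pow_nonneg lpNorm_nonneg _), ENNReal.ofReal_pow lpNorm_nonneg,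
    ENNReal.ofReal_pow lpNorm_nonneg, ofReal_lpNorm hη, ofReal_lpNorm hξ]

end Moments

/-! ### Symmetrization -/

section Symmetrization

theorem lpNorm_rpow_eq_integral {X F : Type*} [MeasurableSpace X] [NormedAddCommGroup F]
    {μ : Measure X} {f : X → F}
    (hf : AEStronglyMeasurable f μ) {q : ℝ} (hq : 0 < q) :
    lpNorm f (ENNReal.ofReal q) μ ^ q = ∫ x, ‖f x‖ ^ q ∂μ := by
  have h0 : 0 ≤ ∫ x, ‖f x‖ ^ q ∂μ := integral_nonneg fun x => Real.rpow_nonneg (norm_nonneg _) _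
  rw [lpNorm_eq_integral_norm_rpow_toReal (by simpa using hq) ENNReal.ofReal_ne_top hf,
    ENNReal.toReal_ofReal hq.le, ← Real.rpow_mul h0, inv_mul_cancel₀ hq.ne', Real.rpow_one]

theorem integrable_norm_rpow_of_memLp {X F : Type*} [MeasurableSpace X] [NormedAddCommGroup F]
    {μ : Measure X} {f : X → F}
    {q : ℝ} (hq : 0 < q) (hf : MemLp f (ENNReal.ofReal q) μ) :
    Integrable (fun x => ‖f x‖ ^ q) μ := by
  simpa [ENNReal.toReal_ofReal hq.le] using
    hf.integrable_norm_rpow (by simpa using hq) ENNReal.ofReal_ne_top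

variable {F : Type*} [NormedAddCommGroup F] [NormedSpace ℝ F]

/-- Write `G x - ∫ G` as the integral of `G x - G y` over `y` and compare `L₁` with `L_q` in `y`,
which is Jensen's inequality on a probability space. -/
theorem eLpNorm_sub_integral_le {X : Type*} [MeasurableSpace X] {μ : Measure X}
    [IsProbabilityMeasure μ] [CompleteSpace F] {G : X → F} (hG : StronglyMeasurable G)
    (hint : Integrable G μ) {q : ℝ} (hq : 1 ≤ q) :
    eLpNorm (fun x => G x - ∫ y, G y ∂μ) (ENNReal.ofReal q) μ
      ≤ eLpNorm (fun z : X × X => G z.1 - G z.2) (ENNReal.ofReal q) (μ.prod μ) := by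
  have hq0 : 0 < q := by linarith
  have hne : ENNReal.ofReal q ≠ 0 := by simpa using hq0
  have hdiff : StronglyMeasurable fun z : X × X => G z.1 - G z.2 :=
    (hG.comp_measurable measurable_fst).sub (hG.comp_measurable measurable_snd)
  rw [eLpNorm_eq_lintegral_rpow_enorm_toReal hne ENNReal.ofReal_ne_top,
    eLpNorm_eq_lintegral_rpow_enorm_toReal hne ENNReal.ofReal_ne_top, ENNReal.toReal_ofReal hq0.le]
  refine ENNReal.rpow_le_rpow ?_ (by positivity)
  rw [lintegral_prod _ (hdiff.enorm.pow_const q).aemeasurable]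
  refine lintegral_mono fun x => ?_
  have h1 : G x - ∫ y, G y ∂μ = ∫ y, (G x - G y) ∂μ := by
    rw [integral_sub (integrable_const _) hint]
    simp
  have hmeas : AEStronglyMeasurable (fun y => G x - G y) μ :=
    (stronglyMeasurable_const.sub hG).aestronglyMeasurable
  have h2 := eLpNorm_le_eLpNorm_of_exponent_le
    (by simpa using hq : (1 : ℝ≥0∞) ≤ ENNReal.ofReal q) hmeas
  rw [eLpNorm_one_eq_lintegral_enorm, eLpNorm_eq_lintegral_rpow_enorm_toReal hne
    ENNReal.ofReal_ne_top, ENNReal.toReal_ofReal hq0.le] at h2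
  rw [h1]
  calc ‖∫ y, (G x - G y) ∂μ‖ₑ ^ q
      ≤ ((∫⁻ y, ‖G x - G y‖ₑ ^ q ∂μ) ^ (1 / q)) ^ q :=
        ENNReal.rpow_le_rpow ((enorm_integral_le_lintegral_enorm _).trans h2) hq0.le
    _ = _ := by rw [← ENNReal.rpow_mul, one_div_mul_cancel hq0.ne', ENNReal.rpow_one]

variable {S : Type*} [MeasurableSpace S] {ν : Measure S} [IsProbabilityMeasure ν] {n : ℕ}
  {g : S → F}

theorem stronglyMeasurable_signed_sum (hg : StronglyMeasurable g) (e : Fin n → ℝ) :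
    StronglyMeasurable fun x : Fin n → S => ∑ j, e j • g (x j) :=
  Finset.stronglyMeasurable_fun_sum _ fun j _ =>
    (hg.comp_measurable (measurable_pi_apply j)).const_smul (e j)

theorem memLp_signed_sum {s : ℝ≥0∞} (hg : MemLp g s ν) (e : Fin n → ℝ) :
    MemLp (fun x : Fin n → S => ∑ j, e j • g (x j)) s (Measure.pi fun _ => ν) :=
  memLp_finsetSum _ fun j _ =>
    (hg.comp_measurePreserving (measurePreserving_eval (fun _ : Fin n => ν) j)).const_smul (e j)

/-- Exchanging coordinates between two independent copies changes signs of the differences. -/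
theorem eLpNorm_sum_sub_eq (hg : StronglyMeasurable g) (ε : Fin n → Bool) (s : ℝ≥0∞) :
    eLpNorm (fun z : (Fin n → S) × (Fin n → S) => ∑ j, (g (z.1 j) - g (z.2 j))) s
        ((Measure.pi fun _ => ν).prod (Measure.pi fun _ => ν))
      = eLpNorm (fun z : (Fin n → S) × (Fin n → S) =>
          ∑ j, boolSign (ε j) • (g (z.1 j) - g (z.2 j))) s
        ((Measure.pi fun _ => ν).prod (Measure.pi fun _ => ν)) := by
  have hΦ := measurePreserving_arrowProdEquivProdArrow S S (Fin n) (fun _ => ν) (fun _ => ν)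
  -- Swap the two copies in exactly the coordinates of sign `-1`. This preserves the product measure
  -- once the pair of samples is read as a sample of pairs.
  set σ : Fin n → S × S → S × S := fun j => if ε j then id else Prod.swap with hσ
  have hswap := measurePreserving_pi (fun _ : Fin n => ν.prod ν) (fun _ => ν.prod ν) (f := σ)
    (fun j => by
      simp only [hσ]
      split_ifs
      · exact MeasurePreserving.id _
      · exact Measure.measurePreserving_swap)
  have hm : StronglyMeasurable
      fun z : (Fin n → S) × (Fin n → S) => ∑ j, (g (z.1 j) - g (z.2 j)) :=
    Finset.stronglyMeasurable_fun_sum _ fun j _ =>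
      (hg.comp_measurable ((measurable_pi_apply j).comp measurable_fst)).sub
        (hg.comp_measurable ((measurable_pi_apply j).comp measurable_snd))
  have hT := (hΦ.comp hswap).comp (hΦ.symm _)
  rw [← eLpNorm_comp_measurePreserving hm.aestronglyMeasurable hT]
  congr 1
  funext z
  refine Finset.sum_congr rfl fun j _ => ?_
  change g (σ j (z.1 j, z.2 j)).1 - g (σ j (z.1 j, z.2 j)).2 = _
  cases h : ε j <;> simp [hσ, h, boolSign]

/-- Compare with an independent copy, insert the signs, and separate the copies by the triangle
inequality, which costs the factor 2. -/
theorem eLpNorm_sum_sub_integral_le [CompleteSpace F] (hg : StronglyMeasurable g) {q : ℝ}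
    (hq : 1 ≤ q) (hgq : MemLp g (ENNReal.ofReal q) ν) (ε : Fin n → Bool) :
    eLpNorm (fun x : Fin n → S => ∑ j, g (x j) - (n : ℝ) • ∫ s, g s ∂ν) (ENNReal.ofReal q)
        (Measure.pi fun _ => ν)
      ≤ 2 * eLpNorm (fun x : Fin n → S => ∑ j, boolSign (ε j) • g (x j)) (ENNReal.ofReal q)
        (Measure.pi fun _ => ν) := by
  have hq1 : (1 : ℝ≥0∞) ≤ ENNReal.ofReal q := by simpa using hq
  set μ : Measure (Fin n → S) := Measure.pi fun _ => ν with hμ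
  set H : (Fin n → S) → F := fun x => ∑ j, boolSign (ε j) • g (x j) with hH
  have hHm : StronglyMeasurable H := stronglyMeasurable_signed_sum hg _
  have hGm : StronglyMeasurable fun x : Fin n → S => ∑ j, g (x j) := by
    simpa using stronglyMeasurable_signed_sum hg (fun _ : Fin n => (1 : ℝ))
  have hcoord : ∀ j, Integrable (fun x : Fin n → S => g (x j)) μ := fun j =>
    (measurePreserving_eval (fun _ : Fin n => ν) j).integrable_comp_of_integrable
      (hgq.integrable hq1)
  have hmean : ∫ x, ∑ j, g (x j) ∂μ = (n : ℝ) • ∫ s, g s ∂ν := by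
    rw [integral_finsetSum _ fun j _ => hcoord j]
    have : ∀ j : Fin n, ∫ x, g (x j) ∂μ = ∫ s, g s ∂ν := by
      intro j
      have hp := measurePreserving_eval (fun _ : Fin n => ν) j
      rw [← hp.map_eq, integral_map hp.measurable.aemeasurable hg.aestronglyMeasurable]
    simp [this, Nat.cast_smul_eq_nsmul]
  have h1 := eLpNorm_sub_integral_le hGm (integrable_finsetSum _ fun j _ => hcoord j) hq
  rw [hmean] at h1
  refine h1.trans ?_
  have h2 := eLpNorm_sum_sub_eq (ν := ν) hg ε (ENNReal.ofReal q)
  simp only [Finset.sum_sub_distrib, smul_sub] at h2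
  rw [h2]
  refine (eLpNorm_sub_le (f := fun z : (Fin n → S) × (Fin n → S) => H z.1)
    (g := fun z : (Fin n → S) × (Fin n → S) => H z.2)
    (hHm.comp_measurable measurable_fst).aestronglyMeasurable
    (hHm.comp_measurable measurable_snd).aestronglyMeasurable hq1).trans (le_of_eq ?_)
  have e1 := eLpNorm_comp_measurePreserving (p := ENNReal.ofReal q)
    hHm.aestronglyMeasurable (measurePreserving_fst (μ := μ) (ν := μ))
  have e2 := eLpNorm_comp_measurePreserving (p := ENNReal.ofReal q)
    hHm.aestronglyMeasurable (measurePreserving_snd (μ := μ) (ν := μ))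
  simp only [Function.comp_def] at e1 e2
  rw [e1, e2, two_mul]

/-- The previous bound holds for each fixed sign vector, so it may be averaged over the finite cube
without an auxiliary probability space. -/
theorem lpNorm_sum_sub_integral_rpow_le [CompleteSpace F] (hg : StronglyMeasurable g) {q : ℝ}
    (hq : 1 ≤ q) (hgq : MemLp g (ENNReal.ofReal q) ν) :
    Integrable (fun x : Fin n → S => signAvg n fun e => ‖∑ j, e j • g (x j)‖ ^ q)
        (Measure.pi fun _ => ν) ∧
    lpNorm (fun x : Fin n → S => ∑ j, g (x j) - (n : ℝ) • ∫ s, g s ∂ν) (ENNReal.ofReal q)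
        (Measure.pi fun _ => ν) ^ q
      ≤ 2 ^ q * ∫ x, signAvg n (fun e => ‖∑ j, e j • g (x j)‖ ^ q)
        ∂(Measure.pi fun _ : Fin n => ν) := by
  have hq0 : 0 < q := by linarith
  have hint : ∀ ε : Fin n → Bool, Integrable
      (fun x : Fin n → S => ‖∑ j, boolSign (ε j) • g (x j)‖ ^ q) (Measure.pi fun _ => ν) :=
    fun ε => integrable_norm_rpow_of_memLp hq0 (memLp_signed_sum hgq _)
  refine ⟨(integrable_finsetSum _ fun ε _ => hint ε).const_mul _, ?_⟩
  set A := lpNorm (fun x : Fin n → S => ∑ j, g (x j) - (n : ℝ) • ∫ s, g s ∂ν) (ENNReal.ofReal q)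
    (Measure.pi fun _ => ν) ^ q with hA
  have hGm : StronglyMeasurable fun x : Fin n → S => ∑ j, g (x j) - (n : ℝ) • ∫ s, g s ∂ν := by
    have := stronglyMeasurable_signed_sum hg (fun _ : Fin n => (1 : ℝ))
    simp only [one_smul] at this
    exact this.sub stronglyMeasurable_const
  have hle : ∀ ε : Fin n → Bool, A ≤ 2 ^ q * ∫ x, ‖∑ j, boolSign (ε j) • g (x j)‖ ^ q
      ∂(Measure.pi fun _ : Fin n => ν) := by
    intro ε
    have hmem := memLp_signed_sum hgq fun j => boolSign (ε j)
    have h1 := ENNReal.toReal_mono (ENNReal.mul_ne_top ENNReal.ofNat_ne_top hmem.eLpNorm_ne_top)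
      (eLpNorm_sum_sub_integral_le hg hq hgq ε)
    rw [ENNReal.toReal_mul, toReal_eLpNorm hGm.aestronglyMeasurable, toReal_eLpNorm hmem.1] at h1
    rw [← lpNorm_rpow_eq_integral hmem.1 hq0, ← Real.mul_rpow (by norm_num) lpNorm_nonneg]
    exact Real.rpow_le_rpow lpNorm_nonneg h1 hq0.le
  have e : ∫ x, signAvg n (fun e => ‖∑ j, e j • g (x j)‖ ^ q) ∂(Measure.pi fun _ : Fin n => ν)
      = ((2 : ℝ) ^ n)⁻¹ * ∑ ε : Fin n → Bool, ∫ x, ‖∑ j, boolSign (ε j) • g (x j)‖ ^ q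
        ∂(Measure.pi fun _ : Fin n => ν) := by
    simp only [signAvg]
    rw [integral_const_mul, integral_finsetSum _ fun ε _ => hint ε]
  calc A = ((2 : ℝ) ^ n)⁻¹ * ∑ _ε : Fin n → Bool, A := by
        rw [Finset.sum_const, Finset.card_univ]
        simp
    _ ≤ ((2 : ℝ) ^ n)⁻¹ * ∑ ε : Fin n → Bool, 2 ^ q * ∫ x, ‖∑ j, boolSign (ε j) • g (x j)‖ ^ q
        ∂(Measure.pi fun _ : Fin n => ν) :=
        mul_le_mul_of_nonneg_left (Finset.sum_le_sum fun ε _ => hle ε) (by positivity)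
    _ = _ := by rw [e, ← Finset.mul_sum]; ring

end Symmetrization

/-! ### The error of the sample mean -/

section SampleMean

theorem lpNorm_comp_of_measurePreserving {X Y F : Type*} [MeasurableSpace X] [MeasurableSpace Y]
    [NormedAddCommGroup F] {μ : Measure X} {ν : Measure Y} {f : X → Y} {g : Y → F} {s : ℝ≥0∞}
    (hg : AEStronglyMeasurable g ν) (hf : MeasurePreserving f μ ν) :
    lpNorm (g ∘ f) s μ = lpNorm g s ν := by
  rw [← toReal_eLpNorm hg, ← toReal_eLpNorm (hg.comp_measurePreserving hf),
    eLpNorm_comp_measurePreserving hg hf]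

theorem lpNorm_congr_ae {X F : Type*} [MeasurableSpace X] [NormedAddCommGroup F] {μ : Measure X}
    {f g : X → F} {s : ℝ≥0∞} (h : f =ᵐ[μ] g) : lpNorm f s μ = lpNorm g s μ := by
  by_cases hf : AEStronglyMeasurable f μ
  · rw [← toReal_eLpNorm hf, ← toReal_eLpNorm (hf.congr h), eLpNorm_congr_ae h]
  · rw [lpNorm_of_not_aestronglyMeasurable hf,
      lpNorm_of_not_aestronglyMeasurable fun hg => hf (hg.congr h.symm)]

variable {k : ℕ} {q : ℝ}

theorem norm_symTensorPow_rpow_le {E : Type*} [NormedAddCommGroup E] [NormedSpace ℝ E]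
    (hq : 0 ≤ q) (x : E) : ‖symTensorPow k x‖ ^ q ≤ ‖x‖ ^ (k * q) := by
  rw [Real.rpow_mul (norm_nonneg x), Real.rpow_natCast]
  exact Real.rpow_le_rpow (norm_nonneg _) (norm_symTensorPow_le x) hq

theorem memLp_symTensorPow {X E : Type*} [MeasurableSpace X] [NormedAddCommGroup E]
    [NormedSpace ℝ E] {μ : Measure X} {ξ : X → E} (hk : 0 < k) (hq : 0 < q)
    (hξ : MemLp ξ (ENNReal.ofReal (k * q)) μ) :
    MemLp (fun x => symTensorPow k (ξ x)) (ENNReal.ofReal q) μ := by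
  have hm := (continuous_symTensorPow k E).comp_aestronglyMeasurable hξ.1
  have hkq : 0 < k * q := mul_pos (by exact_mod_cast hk) hq
  refine (integrable_norm_rpow_iff hm (by simpa using hq) ENNReal.ofReal_ne_top).1 ?_
  rw [ENNReal.toReal_ofReal hq.le]
  refine (integrable_norm_rpow_of_memLp hkq hξ).mono'
    (hm.norm.aemeasurable.pow_const q).aestronglyMeasurable
    (.of_forall fun x => ?_)
  rw [Real.norm_of_nonneg (Real.rpow_nonneg (norm_nonneg _) _)]
  exact norm_symTensorPow_rpow_le hq.le (ξ x)

universe u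

variable {Ω : Type*} [MeasurableSpace Ω] {P : Measure Ω} [IsProbabilityMeasure P]
  {E : Type u} [NormedAddCommGroup E]

/-- Independent identically distributed random variables can be realized, up to null sets, as the
image of a product measure. -/
theorem exists_measurePreserving_pi [MeasurableSpace E] [BorelSpace E] {n : ℕ} (hn : 0 < n)
    {ξ : Fin n → Ω → E} (hξ : ∀ j, AEStronglyMeasurable (ξ j) P) (hindep : iIndepFun ξ P)
    (hident : ∀ i j, IdentDistrib (ξ i) (ξ j) P P) :
    ∃ (S : Type u) (_ : MeasurableSpace S) (ν : Measure S) (_ : IsProbabilityMeasure ν)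
      (X : S → E) (ζ : Fin n → Ω → S), StronglyMeasurable X ∧
      -- `S` will be a separable subset of `E` containing the ranges of strongly measurable
      -- versions, and `X` its inclusion, so that `E` itself need not be separable.
      (∀ j, (fun ω => X (ζ j ω)) =ᵐ[P] ξ j) ∧ MeasurePreserving (ζ ⟨0, hn⟩) P ν ∧
      MeasurePreserving (fun ω j => ζ j ω) P (Measure.pi fun _ => ν) := by
  set ξ' : Fin n → Ω → E := fun j => (hξ j).mk with hξ'
  have hsm : ∀ j, StronglyMeasurable (ξ' j) := fun j => (hξ j).stronglyMeasurable_mk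
  have hae : ∀ j, ξ' j =ᵐ[P] ξ j := fun j => (hξ j).ae_eq_mk.symm
  set t : Set E := ⋃ j, Set.range (ξ' j) with ht
  have htsep : TopologicalSpace.IsSeparable t :=
    TopologicalSpace.IsSeparable.iUnion fun j => (hsm j).isSeparable_range
  have : TopologicalSpace.SeparableSpace t := htsep.separableSpace
  have : SecondCountableTopology t := UniformSpace.secondCountable_of_separable t
  set ζ : Fin n → Ω → t := fun j ω => ⟨ξ' j ω, Set.mem_iUnion.2 ⟨j, ω, rfl⟩⟩ with hζ
  have hζm : ∀ j, Measurable (ζ j) := fun j => (hsm j).measurable.subtype_mk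
  have hlaw : ∀ j, P.map (ζ j) = P.map (ζ ⟨0, hn⟩) := by
    -- Measurable sets of the subtype are traces of measurable sets of `E`, so laws can be compared
    -- in `E`.
    intro j
    refine Measure.ext fun A hA => ?_
    obtain ⟨B, hB, rfl⟩ := hA
    have key : ∀ i, P.map (ζ i) (Subtype.val ⁻¹' B) = P.map (ξ i) B := by
      intro i
      rw [Measure.map_apply (hζm i) (measurable_subtype_coe hB), ← Measure.map_congr (hae i),
        Measure.map_apply (hsm i).measurable hB]
      rfl
    rw [key, key, (hident j ⟨0, hn⟩).map_eq]
  have hind : iIndepFun ζ P := by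
    have h1 := hindep.congr fun j => (hae j).symm
    rw [iIndepFun_iff_measure_inter_preimage_eq_mul] at h1 ⊢
    intro T sets hs
    choose! B hB hBs using hs
    have e : ∀ i ∈ T, ζ i ⁻¹' sets i = ξ' i ⁻¹' B i := fun i hi => by
      rw [← hBs i hi]
      rfl
    rw [Finset.prod_congr rfl fun i hi => by rw [e i hi], Set.iInter₂_congr e]
    exact h1 T hB
  have hprob : IsProbabilityMeasure (P.map (ζ ⟨0, hn⟩)) :=
    Measure.isProbabilityMeasure_map (hζm _).aemeasurable
  refine ⟨t, inferInstance, P.map (ζ ⟨0, hn⟩), hprob, Subtype.val, ζ,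
    continuous_subtype_val.stronglyMeasurable, hae, (hζm _).measurePreserving P,
    measurable_pi_iff.2 hζm, ?_⟩
  rw [(iIndepFun_iff_map_fun_eq_pi_map fun j => (hζm j).aemeasurable).1 hind]
  simp only [hlaw]

theorem memLp_natCast_of_memLp_mul {ξ : Ω → E} (hq : 1 ≤ q)
    (hξ : MemLp ξ (ENNReal.ofReal (k * q)) P) : MemLp ξ k P := by
  refine hξ.mono_exponent ?_
  rw [← ENNReal.ofReal_natCast]
  exact ENNReal.ofReal_le_ofReal (le_mul_of_one_le_right (by positivity) hq)

variable [NormedSpace ℝ E]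

/-- Contraction, then Kahane and type `p` for the vectors `‖xⱼ‖ ^ (k - 1) xⱼ`, of norm `‖xⱼ‖ ^ k`.
As `q / p ≥ 1`, the power mean inequality turns the sum of `p`-th powers into one that can be
integrated termwise. -/
theorem signAvg_norm_symTensorPow_le_sum [CompleteSpace E] {p : ℝ} (hp : 1 ≤ p) (hpq : p ≤ q)
    (hE : HasRademacherType E p) (hk : 0 < k) {n : ℕ} (x : Fin n → E) :
    signAvg n (fun e => ‖∑ j, e j • symTensorPow k (x j)‖ ^ q)
      ≤ (2 * k * kahaneKhintchineConstant.{u} q p * typeConstant E p) ^ q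
        * ((n : ℝ) ^ (q / p - 1) * ∑ j, ‖x j‖ ^ (k * q)) := by
  have hq : 1 ≤ q := hp.trans hpq
  have hp0 : 0 < p := by linarith
  have hK := kahaneKhintchineConstant_nonneg.{u} q p
  have hτ := typeConstant_nonneg (F := E) p
  have hy : ∀ j, ‖‖x j‖ ^ (k - 1) • x j‖ = ‖x j‖ ^ k := fun j => by
    rw [norm_smul, norm_pow, norm_norm, ← pow_succ, Nat.sub_add_cancel hk]
  have h1 := signAvg_norm_rpow_le hp hpq hE fun j => ‖x j‖ ^ (k - 1) • x j
  have h2 : (∑ j, ‖‖x j‖ ^ (k - 1) • x j‖ ^ p) ^ (q / p)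
      ≤ (n : ℝ) ^ (q / p - 1) * ∑ j, ‖x j‖ ^ (k * q) := by
    have h3 := Real.rpow_sum_le_const_mul_sum_rpow_of_nonneg (Finset.univ : Finset (Fin n))
      (f := fun j => ‖‖x j‖ ^ (k - 1) • x j‖ ^ p) ((one_le_div hp0).2 hpq)
      fun j _ => Real.rpow_nonneg (norm_nonneg _) _
    rw [Finset.card_univ, Fintype.card_fin] at h3
    refine h3.trans (le_of_eq ?_)
    congr 1
    refine Finset.sum_congr rfl fun j _ => ?_
    rw [hy, ← Real.rpow_natCast, ← Real.rpow_mul (norm_nonneg _), ← Real.rpow_mul (norm_nonneg _)]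
    congr 1
    field_simp
  calc signAvg n (fun e => ‖∑ j, e j • symTensorPow k (x j)‖ ^ q)
      ≤ (2 * k) ^ q * signAvg n fun e => ‖∑ j, e j • ‖x j‖ ^ (k - 1) • x j‖ ^ q :=
        signAvg_norm_symTensorPow_le hq hk x
    _ ≤ (2 * k) ^ q * ((kahaneKhintchineConstant.{u} q p * typeConstant E p) ^ q
        * ((n : ℝ) ^ (q / p - 1) * ∑ j, ‖x j‖ ^ (k * q))) :=
        mul_le_mul_of_nonneg_left (h1.trans (mul_le_mul_of_nonneg_left h2
          (Real.rpow_nonneg (mul_nonneg hK hτ) _))) (by positivity)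
    _ = _ := by
        rw [← mul_assoc, ← Real.mul_rpow (by positivity) (mul_nonneg hK hτ),
          ← mul_assoc (2 * (k : ℝ))]

/-- The error of the sample mean on a product space. -/
theorem lpNorm_sum_symTensorPow_sub_le_pi [CompleteSpace E] {p : ℝ} (hp : 1 ≤ p) (hpq : p ≤ q)
    (hE : HasRademacherType E p) (hk : 0 < k) {n : ℕ} (hn : 0 < n) {S : Type*} [MeasurableSpace S]
    {ν : Measure S} [IsProbabilityMeasure ν] {X : S → E} (hX : StronglyMeasurable X)
    (hXq : MemLp X (ENNReal.ofReal (k * q)) ν) :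
    lpNorm (fun x : Fin n → S => ∑ j, symTensorPow k (X (x j))
        - (n : ℝ) • ∫ s, symTensorPow k (X s) ∂ν) (ENNReal.ofReal q) (Measure.pi fun _ => ν)
      ≤ 2 * (2 * k * kahaneKhintchineConstant.{u} q p * typeConstant E p) * (n : ℝ) ^ (1 / p)
        * lpNorm X (ENNReal.ofReal (k * q)) ν ^ k := by
  have hq : 1 ≤ q := hp.trans hpq
  have hq0 : 0 < q := by linarith
  have hp0 : 0 < p := by linarith
  have hn0 : (0 : ℝ) < n := by exact_mod_cast hn
  have hkq : 0 < k * q := mul_pos (by exact_mod_cast hk) hq0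
  have hK := kahaneKhintchineConstant_nonneg.{u} q p
  have hτ := typeConstant_nonneg (F := E) p
  have hN : 0 ≤ lpNorm X (ENNReal.ofReal (k * q)) ν := lpNorm_nonneg
  set C := 2 * k * kahaneKhintchineConstant.{u} q p * typeConstant E p with hC
  have hC0 : 0 ≤ C := by positivity
  have hg : StronglyMeasurable fun s => symTensorPow k (X s) :=
    (continuous_symTensorPow k E).comp_stronglyMeasurable hX
  obtain ⟨hint, hsym⟩ := lpNorm_sum_sub_integral_rpow_le (n := n) hg hq
    (memLp_symTensorPow hk hq0 hXq)
  have hXint := integrable_norm_rpow_of_memLp hkq hXq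
  have hcoord : ∀ j : Fin n, Integrable (fun x : Fin n → S => ‖X (x j)‖ ^ (k * q))
      (Measure.pi fun _ => ν) := fun j =>
    (measurePreserving_eval (fun _ : Fin n => ν) j).integrable_comp_of_integrable hXint
  have hcoord' : ∀ j : Fin n, ∫ x, ‖X (x j)‖ ^ (k * q) ∂(Measure.pi fun _ : Fin n => ν)
      = lpNorm X (ENNReal.ofReal (k * q)) ν ^ (k * q) := by
    intro j
    have hpres := measurePreserving_eval (fun _ : Fin n => ν) j
    rw [lpNorm_rpow_eq_integral hXq.1 hkq]
    nth_rw 2 [← hpres.map_eq]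
    rw [integral_map hpres.measurable.aemeasurable
      (by rw [hpres.map_eq]; exact hXint.aestronglyMeasurable)]
  have hmono := integral_mono hint
    (((integrable_finsetSum Finset.univ fun j _ => hcoord j).const_mul
      ((n : ℝ) ^ (q / p - 1))).const_mul (C ^ q))
    fun x => signAvg_norm_symTensorPow_le_sum hp hpq hE hk fun j => X (x j)
  rw [integral_const_mul, integral_const_mul, integral_finsetSum _ fun j _ => hcoord j,
    Finset.sum_congr rfl fun j _ => hcoord' j, Finset.sum_const, Finset.card_univ,
    Fintype.card_fin, nsmul_eq_mul, ← mul_assoc ((n : ℝ) ^ _)] at hmono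
  -- The extra factor `n` counts the identically distributed summands.
  have en : (n : ℝ) ^ (q / p - 1) * n = ((n : ℝ) ^ (1 / p)) ^ q := by
    rw [← Real.rpow_add_one hn0.ne', sub_add_cancel, ← Real.rpow_mul hn0.le]
    congr 1
    ring
  rw [en, Real.rpow_mul hN, Real.rpow_natCast, ← Real.mul_rpow (by positivity) (by positivity),
    ← Real.mul_rpow hC0 (by positivity)] at hmono
  have h := hsym.trans (mul_le_mul_of_nonneg_left hmono (by positivity))
  rw [← Real.mul_rpow (by norm_num) (by positivity)] at h
  refine ((Real.rpow_le_rpow_iff lpNorm_nonneg (by positivity) hq0).1 h).trans (le_of_eq ?_)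
  ring

/-- The error of the sum of independent copies of a random tensor power. -/
theorem lpNorm_sum_symTensorPow_sub_le [CompleteSpace E] [MeasurableSpace E] [BorelSpace E] {p : ℝ}
    (hp : 1 ≤ p) (hpq : p ≤ q) (hE : HasRademacherType E p) (hk : 0 < k) {n : ℕ} (hn : 0 < n)
    {ξ : Fin n → Ω → E} (hξ : ∀ j, MemLp (ξ j) (ENNReal.ofReal (k * q)) P)
    (hindep : iIndepFun ξ P) (hident : ∀ i j, IdentDistrib (ξ i) (ξ j) P P) :
    lpNorm (fun ω => ∑ j, symTensorPow k (ξ j ω) - (n : ℝ) • symMoment k (ξ ⟨0, hn⟩) P)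
        (ENNReal.ofReal q) P
      ≤ 2 * (2 * k * kahaneKhintchineConstant.{u} q p * typeConstant E p) * (n : ℝ) ^ (1 / p)
        * lpNorm (ξ ⟨0, hn⟩) (ENNReal.ofReal (k * q)) P ^ k := by
  have hq : 1 ≤ q := hp.trans hpq
  obtain ⟨S, _, ν, _, X, ζ, hX, hae, hζ0, hζ⟩ :=
    exists_measurePreserving_pi hn (fun j => (hξ j).1) hindep hident
  have hXq : MemLp X (ENNReal.ofReal (k * q)) ν := by
    rw [← hζ0.map_eq, memLp_map_measure_iff hX.aestronglyMeasurable hζ0.measurable.aemeasurable]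
    exact (hξ ⟨0, hn⟩).ae_eq (hae ⟨0, hn⟩).symm
  have hnorm : lpNorm (ξ ⟨0, hn⟩) (ENNReal.ofReal (k * q)) P
      = lpNorm X (ENNReal.ofReal (k * q)) ν :=
    (lpNorm_congr_ae (hae ⟨0, hn⟩)).symm.trans
      (lpNorm_comp_of_measurePreserving hX.aestronglyMeasurable hζ0)
  have hg : StronglyMeasurable fun s => symTensorPow k (X s) :=
    (continuous_symTensorPow k E).comp_stronglyMeasurable hX
  have hmom : symMoment k (ξ ⟨0, hn⟩) P = ∫ s, symTensorPow k (X s) ∂ν := by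
    rw [symMoment_eq_integral hk.ne' (memLp_natCast_of_memLp_mul hq (hξ ⟨0, hn⟩)), ← hζ0.map_eq,
      integral_map hζ0.measurable.aemeasurable hg.aestronglyMeasurable]
    refine integral_congr_ae ?_
    filter_upwards [hae ⟨0, hn⟩] with ω hω
    rw [hω]
  have hpi := lpNorm_sum_symTensorPow_sub_le_pi hp hpq hE hk hn hX hXq
  rw [hnorm, hmom]
  refine le_trans (le_of_eq ?_) hpi
  have hm : StronglyMeasurable fun x : Fin n → S => ∑ j, symTensorPow k (X (x j))
      - (n : ℝ) • ∫ s, symTensorPow k (X s) ∂ν :=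
    (Finset.stronglyMeasurable_fun_sum _ fun j _ =>
      hg.comp_measurable (measurable_pi_apply j)).sub stronglyMeasurable_const
  rw [← lpNorm_comp_of_measurePreserving hm.aestronglyMeasurable hζ]
  refine lpNorm_congr_ae ?_
  filter_upwards [Filter.eventually_all.2 hae] with ω hω
  simp only [Function.comp_apply, hω]

/-- The error of the sample mean of independent copies of a random tensor power. -/
theorem lpNorm_symMoment_sub_mean_le [CompleteSpace E] [MeasurableSpace E] [BorelSpace E] {p : ℝ}
    (hp : 1 ≤ p) (hpq : p ≤ q) (hE : HasRademacherType E p) (hk : 0 < k) {n : ℕ} (hn : 0 < n)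
    {ξ : Fin n → Ω → E} (hξ : ∀ j, MemLp (ξ j) (ENNReal.ofReal (k * q)) P)
    (hindep : iIndepFun ξ P) (hident : ∀ i j, IdentDistrib (ξ i) (ξ j) P P) :
    lpNorm (fun ω => symMoment k (ξ ⟨0, hn⟩) P - (n : ℝ)⁻¹ • ∑ j, symTensorPow k (ξ j ω))
        (ENNReal.ofReal q) P
      ≤ singleLevelConstant E q p k * (n : ℝ) ^ (-(1 - 1 / p))
        * lpNorm (ξ ⟨0, hn⟩) (ENNReal.ofReal (k * q)) P ^ k := by
  have hn0 : (0 : ℝ) < n := by exact_mod_cast hn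
  have h := lpNorm_sum_symTensorPow_sub_le hp hpq hE hk hn hξ hindep hident
  have e : (fun ω => symMoment k (ξ ⟨0, hn⟩) P - (n : ℝ)⁻¹ • ∑ j, symTensorPow k (ξ j ω))
      = (-(n : ℝ)⁻¹) • fun ω =>
        ∑ j, symTensorPow k (ξ j ω) - (n : ℝ) • symMoment k (ξ ⟨0, hn⟩) P := by
    funext ω
    rw [Pi.smul_apply, smul_sub, smul_smul, neg_mul, inv_mul_cancel₀ hn0.ne', neg_smul, neg_smul,
      one_smul]
    abel
  rw [e, lpNorm_const_smul]
  have hnorm : (‖(-(n : ℝ)⁻¹)‖₊ : ℝ) = (n : ℝ)⁻¹ := by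
    rw [coe_nnnorm, norm_neg, Real.norm_of_nonneg (by positivity)]
  have hpow : (n : ℝ)⁻¹ * (n : ℝ) ^ (1 / p) = (n : ℝ) ^ (-(1 - 1 / p)) := by
    rw [← Real.rpow_neg_one, ← Real.rpow_add hn0]
    congr 1
    ring
  have hN : 0 ≤ lpNorm (ξ ⟨0, hn⟩) (ENNReal.ofReal (k * q)) P := lpNorm_nonneg
  have hB := khintchineConstant_nonneg q
  calc _ ≤ (n : ℝ)⁻¹ * (2 * (2 * k * kahaneKhintchineConstant.{u} q p * typeConstant E p)
        * (n : ℝ) ^ (1 / p) * lpNorm (ξ ⟨0, hn⟩) (ENNReal.ofReal (k * q)) P ^ k) := by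
        rw [hnorm]
        exact mul_le_mul_of_nonneg_left h (by positivity)
    _ = 2 * (2 * k * kahaneKhintchineConstant.{u} q p * typeConstant E p)
        * (n : ℝ) ^ (-(1 - 1 / p)) * lpNorm (ξ ⟨0, hn⟩) (ENNReal.ofReal (k * q)) P ^ k := by
        rw [← hpow]
        ring
    -- Only `B_q ≥ 0` is needed to reach the stated constant.
    _ ≤ _ := by
        rw [singleLevelConstant]
        gcongr
        linarith

end SampleMean

end MonteCarloMoments

theorem mainTheorem4 {Ω : Type*} [MeasurableSpace Ω] (P : Measure Ω) [IsProbabilityMeasure P]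
    {E : Type*} [NormedAddCommGroup E] [NormedSpace ℝ E] [CompleteSpace E]
    [MeasurableSpace E] [BorelSpace E]
    (p q : ℝ) (hp : p ∈ Set.Icc (1 : ℝ) 2) (hE : HasRademacherType E p) (hq : p ≤ q)
    (k M : ℕ) (hk : 0 < k) (hM : 0 < M) (ξ : Fin M → Ω → E)
    (hξ : ∀ j, MemLp (ξ j) (ENNReal.ofReal (k * q)) P)
    (hindep : iIndepFun ξ P) (hident : ∀ i j, IdentDistrib (ξ i) (ξ j) P P) :
    Integrable (fun ω => tensorPow k (ξ ⟨0, hM⟩ ω)) P ∧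
    (∀ U : SymInjTensor k E,
      MemLp (fun ω => U - (M : ℝ)⁻¹ • ∑ j, symTensorPow k (ξ j ω)) (ENNReal.ofReal q) P ∧
      lpNorm (fun ω => U - (M : ℝ)⁻¹ • ∑ j, symTensorPow k (ξ j ω)) (ENNReal.ofReal q) P
        ≤ ‖U - symMoment k (ξ ⟨0, hM⟩) P‖
          + singleLevelConstant E q p k * (M : ℝ) ^ (-(1 - 1 / p))
            * lpNorm (ξ ⟨0, hM⟩) (ENNReal.ofReal (k * q)) P ^ k) ∧
    (∀ η : Ω → E, MemLp η k P →
      Integrable (fun ω => tensorPow k (η ω)) P ∧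
      ‖symMoment k η P - symMoment k (ξ ⟨0, hM⟩) P‖
        ≤ lpNorm (η - ξ ⟨0, hM⟩) k P
          * ∑ i ∈ Finset.range k, lpNorm η k P ^ i * lpNorm (ξ ⟨0, hM⟩) k P ^ (k - i - 1) ∧
      lpNorm (fun ω => symMoment k η P - (M : ℝ)⁻¹ • ∑ j, symTensorPow k (ξ j ω))
          (ENNReal.ofReal q) P
        ≤ lpNorm (η - ξ ⟨0, hM⟩) k P
            * ∑ i ∈ Finset.range k, lpNorm η k P ^ i * lpNorm (ξ ⟨0, hM⟩) k P ^ (k - i - 1)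
          + singleLevelConstant E q p k * (M : ℝ) ^ (-(1 - 1 / p))
            * lpNorm (ξ ⟨0, hM⟩) (ENNReal.ofReal (k * q)) P ^ k) := by
  have hq1 : 1 ≤ q := hp.1.trans hq
  have hq0 : 0 < q := by linarith
  have hξk : MemLp (ξ ⟨0, hM⟩) k P := memLp_natCast_of_memLp_mul hq1 (hξ ⟨0, hM⟩)
  have hmean : MemLp (fun ω => (M : ℝ)⁻¹ • ∑ j, symTensorPow k (ξ j ω)) (ENNReal.ofReal q) P :=
    (memLp_finsetSum Finset.univ fun j _ =>
      memLp_symTensorPow hk hq0 (hξ j)).const_smul ((M : ℝ)⁻¹)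
  have hU : ∀ U : SymInjTensor k E,
      lpNorm (fun ω => U - (M : ℝ)⁻¹ • ∑ j, symTensorPow k (ξ j ω)) (ENNReal.ofReal q) P
        ≤ ‖U - symMoment k (ξ ⟨0, hM⟩) P‖
          + singleLevelConstant E q p k * (M : ℝ) ^ (-(1 - 1 / p))
            * lpNorm (ξ ⟨0, hM⟩) (ENNReal.ofReal (k * q)) P ^ k := by
    intro U
    have e : (fun ω => U - (M : ℝ)⁻¹ • ∑ j, symTensorPow k (ξ j ω))
        = (fun _ => U - symMoment k (ξ ⟨0, hM⟩) P)
          + fun ω => symMoment k (ξ ⟨0, hM⟩) P - (M : ℝ)⁻¹ • ∑ j, symTensorPow k (ξ j ω) := by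
      funext ω
      simp
    rw [e]
    refine (lpNorm_add_le (memLp_const _) (by simpa using hq1)).trans (add_le_add (le_of_eq ?_)
      (lpNorm_symMoment_sub_mean_le hp.1 hq hE hk hM hξ hindep hident))
    rw [lpNorm_const (by simpa using hq0) (IsProbabilityMeasure.ne_zero P)]
    simp
  refine ⟨integrable_tensorPow hk.ne' hξk, fun U => ⟨(memLp_const U).sub hmean, hU U⟩,
    fun η hη => ?_⟩
  -- The final estimate is `hU` at `U = symMoment k η P`, with this bound on its deterministic term.
  have hdiff := norm_symMoment_sub_le hk.ne' hη hξk
  exact ⟨integrable_tensorPow hk.ne' hη, hdiff, (hU _).trans (by linarith)⟩
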